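/- **Setting.** All graphs are finite, undirected, without loops or multiple edges. A vertex- and edge-colored graph $G$ is a graph together with a color $c(v)$ for every vertex $v$ and a color $c(e)$ for every edge $e$. For an edge color $c$ let $A_{G_c}$ be the $0/1$-matrix with $(A_{G_c})_{ij}=1$ if and only if $(i,j)$ is an edge of color $c$. The quantum automorphism group $\mathrm{Qut}(G)$ is the compact matrix quantum group whose C*-algebra $C(\mathrm{Qut}(G))$ is the universal C*-algebra with generators $u_{ij}$, $i,j\in V(G)$, and relations $u_{ij}=u_{ij}^*=u_{ij}^2$, $\sum_l u_{il}=1=\sum_l u_{li}$, $u_{ij}=0$ if $c(i)\neq c(j)$, and $A_{G_c}u=uA_{G_c}$ for all edge colors $c$. Its comultiplication is $\Delta(u_{ij})=\sum_k u_{ik}\otimes u_{kj}$ (minimal tensor product). For a graph that is not vertex-colored (or not edge-colored), all vertices (or all edges) are taken to have one color. **Construction of $G'$ and $G''$.** Let $G$ be a vertex- and edge-colored graph and fix an edge color $c_0$. Choose $n_c\in\mathbb N_0$ for the vertex colors $c$ of $G$ with $n_{c_1}\ne n_{c_2}$ for $c_1\neq c_2$. The edge-colored graph $G'$ arises from $G$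 by attaching to every vertex of color $c$ a path of length $n_c$ (that is, with $n_c$ new vertices and $n_c$ new edges), giving all new edges the color $c_0$, and forgetting the vertex colors. Choose $m_c\in\mathbb N_0$ for the edge colors $c\neq c_0$ of $G$ with $m_{c_1}\ne m_{c_2}$ for $c_1\neq c_2$. The uncolored graph $G''$ arises from $G'$ by subdividing every edge $e$ of color $c(e)\neq c_0$ by one new vertex, attaching to this new vertex a path of length $m_{c(e)}$, and forgetting the edge colors. **The quantum group $\mathrm{Qut}^*_{c_0}(G')$.** This is the compact matrix quantum group whose C*-algebra is the universal C*-algebra with generators $x_{ij}$, $i,j\in V(G')$, and relations $x_{ij}=x_{ij}^*=x_{ij}^2$, $\sum_l x_{il}=1=\sum_l x_{li}$, $xA_{G'_c}=A_{G'_c}x$ for every edge color $c$, and $x_{ik}x_{jl}=x_{jl}x_{ik}$ whenever $(i,j)$ and $(k,l)$ are edges of $G'$ with $c((i,j))=c((k,l))\neq c_0$; its comultiplication is $\Delta(x_{ij})=\sum_k x_{ik}\otimes x_{kj}$. **Theorem.** Let $G$ be a vertex- and edge-colored graph such that $\deg(v)\ge 3$ for all $v\in V(G)$, and let $G'$, $G''$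 be as above. Then there exists a $*$-isomorphism $\varphi: C(\mathrm{Qut}^*_{c_0}(G'))\to C(\mathrm{Qut}(G''))$ such that $$\Delta_{\mathrm{Qut}(G'')}\circ\varphi=(\varphi\otimes\varphi)\circ\Delta_{\mathrm{Qut}^*_{c_0}(G')}.$$ In other words, $\mathrm{Qut}(G'')\cong \mathrm{Qut}^*_{c_0}(G')$ as compact quantum groups. -/

import Mathlib

open scoped TensorProduct

set_option linter.unusedSectionVars false

noncomputable section

universe u

/-! ### C*-seminorms and the C*-algebras they generate -/

/-- A C*-seminorm on a unital complex *-algebra. -/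
structure CStarSeminorm (A : Type*) [Ring A] [StarRing A] [Algebra ℂ A] extends
    Seminorm ℂ A where
  mul_le' : ∀ a b : A, toFun (a * b) ≤ toFun a * toFun b
  star_mul_self' : ∀ a : A, toFun (star a * a) = toFun a ^ 2

namespace CStarSeminorm

section Basic

variable {A : Type*} [Ring A] [StarRing A] [Algebra ℂ A]

instance : CoeFun (CStarSeminorm A) fun _ => A → ℝ := ⟨fun p => p.toFun⟩

variable (p : CStarSeminorm A)

theorem nonneg (a : A) : 0 ≤ p a := apply_nonneg p.toSeminorm a

theorem map_zero : p 0 = 0 := _root_.map_zero p.toSeminorm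

theorem add_le (a b : A) : p (a + b) ≤ p a + p b := map_add_le_add p.toSeminorm a b

theorem map_neg (a : A) : p (-a) = p a := map_neg_eq_map p.toSeminorm a

theorem map_smul (c : ℂ) (a : A) : p (c • a) = ‖c‖ * p a := map_smul_eq_mul p.toSeminorm c a

theorem mul_le (a b : A) : p (a * b) ≤ p a * p b := p.mul_le' a b

theorem star_mul_self (a : A) : p (star a * a) = p a ^ 2 := p.star_mul_self' a

theorem le_star (a : A) : p a ≤ p (star a) := by
  have h := p.mul_le (star a) a
  rw [p.star_mul_self, sq] at h
  rcases (p.nonneg a).eq_or_lt with h0 | h0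
  · rw [← h0]; exact p.nonneg _
  · exact le_of_mul_le_mul_right h h0

theorem map_star (a : A) : p (star a) = p a :=
  le_antisymm (by simpa using p.le_star (star a)) (p.le_star a)

/-- The C*-seminorm `a ↦ ‖f a‖` induced by a *-homomorphism into a C*-algebra. -/
def ofStarHom {B : Type*} [CStarAlgebra B] (f : A →⋆ₐ[ℂ] B) : CStarSeminorm A where
  toFun a := ‖f a‖
  map_zero' := by simp
  add_le' a b := by simpa using norm_add_le (f a) (f b)
  neg' a := by simp
  smul' c a := by simp [norm_smul]
  mul_le' a b := by simpa using norm_mul_le (f a) (f b)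
  star_mul_self' a := by
    rw [map_mul, StarHomClass.map_star, CStarRing.norm_star_mul_self, sq]

/-- The pointwise supremum of a pointwise bounded family of C*-seminorms. -/
def supr {ι : Type*} (q : ι → CStarSeminorm A)
    (hq : ∀ a, BddAbove (Set.range fun i => q i a)) : CStarSeminorm A where
  toFun a := ⨆ i, q i a
  map_zero' := by simp [map_zero]
  add_le' a b := Real.iSup_le (fun i => ((q i).add_le a b).trans
    (add_le_add (le_ciSup (hq a) i) (le_ciSup (hq b) i)))
    (add_nonneg (Real.iSup_nonneg fun i => (q i).nonneg a)
      (Real.iSup_nonneg fun i => (q i).nonneg b))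
  neg' a := by simp [map_neg]
  smul' c a := by
    simp only [map_smul]
    exact (Real.mul_iSup_of_nonneg (norm_nonneg c) _).symm
  mul_le' a b := Real.iSup_le (fun i => ((q i).mul_le a b).trans
    (mul_le_mul (le_ciSup (hq a) i) (le_ciSup (hq b) i) ((q i).nonneg b)
      (Real.iSup_nonneg fun i => (q i).nonneg a)))
    (mul_nonneg (Real.iSup_nonneg fun i => (q i).nonneg a)
      (Real.iSup_nonneg fun i => (q i).nonneg b))
  star_mul_self' a := by
    have h0 : 0 ≤ ⨆ i, q i a := Real.iSup_nonneg fun i => (q i).nonneg a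
    apply le_antisymm
    · refine Real.iSup_le (fun i => ?_) (by positivity)
      rw [star_mul_self]
      exact pow_le_pow_left₀ ((q i).nonneg a) (le_ciSup (hq a) i) 2
    · have h1 : 0 ≤ ⨆ i, q i (star a * a) := Real.iSup_nonneg fun i => (q i).nonneg _
      have : (⨆ i, q i a) ≤ √(⨆ i, q i (star a * a)) := by
        refine Real.iSup_le (fun i => Real.le_sqrt_of_sq_le ?_) (Real.sqrt_nonneg _)
        rw [← star_mul_self]
        exact le_ciSup (hq (star a * a)) i
      calc (⨆ i, q i a) ^ 2 ≤ √(⨆ i, q i (star a * a)) ^ 2 := pow_le_pow_left₀ h0 this 2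
        _ = _ := Real.sq_sqrt h1

theorem supr_apply {ι : Type*} (q : ι → CStarSeminorm A)
    (hq : ∀ a, BddAbove (Set.range fun i => q i a)) (a : A) :
    supr q hq a = ⨆ i, q i a := rfl

theorem le_supr {ι : Type*} (q : ι → CStarSeminorm A)
    (hq : ∀ a, BddAbove (Set.range fun i => q i a)) (i : ι) (a : A) :
    q i a ≤ supr q hq a := le_ciSup (hq a) i

/-- The *-algebra `A`, regarded as a seminormed algebra by means of `p`. -/
def Pre (_ : CStarSeminorm A) : Type _ := A

instance : SeminormedRing p.Pre where
  __ : Ring p.Pre := inferInstanceAs (Ring A)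
  __ : SeminormedAddCommGroup p.Pre :=
    (p.toSeminorm.toAddGroupSeminorm.toSeminormedAddCommGroup : SeminormedAddCommGroup A)
  norm_mul_le := p.mul_le'

instance : StarRing p.Pre := inferInstanceAs (StarRing A)
instance : Algebra ℂ p.Pre := inferInstanceAs (Algebra ℂ A)

/-- The identity map from `A` to its seminormed copy. -/
def toPre : A →⋆ₐ[ℂ] p.Pre := StarAlgHom.id ℂ A

instance : NormedAlgebra ℂ p.Pre where
  norm_smul_le c a := (p.map_smul c a).le

theorem norm_toPre (a : A) : ‖p.toPre a‖ = p a := rfl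

/-- The separated completion of `A` with respect to the C*-seminorm `p`. -/
abbrev Completion : Type _ := UniformSpace.Completion p.Pre

instance : NormedAlgebra ℂ p.Completion where
  norm_smul_le c a := norm_smul_le c a

/-- The canonical map of `A` into its completion, as an algebra homomorphism. -/
def coeAlgHom : A →ₐ[ℂ] p.Completion where
  toFun a := ((p.toPre a : p.Pre) : UniformSpace.Completion p.Pre)
  map_one' := UniformSpace.Completion.coe_one _
  map_mul' a b := UniformSpace.Completion.coe_mul (p.toPre a) (p.toPre b)
  map_zero' := UniformSpace.Completion.coe_zero
  map_add' a b := UniformSpace.Completion.coe_add (p.toPre a) (p.toPre b)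
  commutes' _ := rfl

theorem norm_coeAlgHom (a : A) : ‖p.coeAlgHom a‖ = p a :=
  UniformSpace.Completion.norm_coe (p.toPre a)

theorem denseRange_coeAlgHom : DenseRange p.coeAlgHom :=
  UniformSpace.Completion.denseRange_coe (α := p.Pre)

theorem induction_on {P : p.Completion → Prop} (x : p.Completion) (hc : IsClosed {x | P x})
    (h : ∀ a, P (p.coeAlgHom a)) : P x :=
  UniformSpace.Completion.induction_on (α := p.Pre) x hc h

theorem induction_on₂ {P : p.Completion → p.Completion → Prop} (x y : p.Completion)
    (hc : IsClosed {x : p.Completion × p.Completion | P x.1 x.2})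
    (h : ∀ a b, P (p.coeAlgHom a) (p.coeAlgHom b)) : P x y :=
  UniformSpace.Completion.induction_on₂ (α := p.Pre) (β := p.Pre) x y hc h

theorem isometry_starPre : Isometry (star : p.Pre → p.Pre) :=
  AddMonoidHomClass.isometry_of_norm (starAddEquiv : p.Pre ≃+ p.Pre) fun a => p.map_star a

instance : Star p.Completion where
  star := UniformSpace.Completion.map (star : p.Pre → p.Pre)

theorem star_coeAlgHom (a : A) : star (p.coeAlgHom a) = p.coeAlgHom (star a) :=
  UniformSpace.Completion.map_coe p.isometry_starPre.uniformContinuous (p.toPre a)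

instance : ContinuousStar p.Completion where
  continuous_star := UniformSpace.Completion.continuous_map (f := (star : p.Pre → p.Pre))

instance : StarRing p.Completion where
  star_involutive x := by
    refine p.induction_on (P := fun x => star (star x) = x) x
      (isClosed_eq (by fun_prop) (by fun_prop)) fun a => ?_
    simp only [star_coeAlgHom, star_star]
  star_mul x y := by
    refine p.induction_on₂ (P := fun x y => star (x * y) = star y * star x) x y
      (isClosed_eq (by fun_prop) (by fun_prop)) fun a b => ?_
    rw [← map_mul, star_coeAlgHom, star_coeAlgHom, star_coeAlgHom, ← map_mul, star_mul]
  star_add x y := by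
    refine p.induction_on₂ (P := fun x y => star (x + y) = star x + star y) x y
      (isClosed_eq (by fun_prop) (by fun_prop)) fun a b => ?_
    rw [← map_add, star_coeAlgHom, star_coeAlgHom, star_coeAlgHom, ← map_add, star_add]

instance : CStarRing p.Completion where
  norm_mul_self_le x := by
    refine p.induction_on (P := fun x => ‖x‖ * ‖x‖ ≤ ‖star x * x‖) x
      (isClosed_le (by fun_prop) (by fun_prop)) fun a => ?_
    rw [star_coeAlgHom, ← map_mul, norm_coeAlgHom, norm_coeAlgHom, star_mul_self, sq]

/-- The canonical *-homomorphism of `A` into its completion. -/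
def coe : A →⋆ₐ[ℂ] p.Completion where
  __ := p.coeAlgHom
  map_star' a := (p.star_coeAlgHom a).symm

theorem norm_coe (a : A) : ‖p.coe a‖ = p a := p.norm_coeAlgHom a

theorem denseRange_coe : DenseRange p.coe := p.denseRange_coeAlgHom

variable {B : Type*} [CStarAlgebra B]

/-- A *-homomorphism out of `A`, regarded as a ring homomorphism out of the seminormed copy. -/
def preHom (f : A →⋆ₐ[ℂ] B) : p.Pre →+* B := (f : A →+* B)

theorem continuous_preHom (f : A →⋆ₐ[ℂ] B) (hf : ∀ a, ‖f a‖ ≤ p a) :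
    Continuous (p.preHom f) :=
  AddMonoidHomClass.continuous_of_bound (p.preHom f) 1
    fun a => (hf a).trans_eq (one_mul _).symm

theorem extension_coe (f : A →⋆ₐ[ℂ] B) (hf : ∀ a, ‖f a‖ ≤ p a) (a : A) :
    UniformSpace.Completion.extensionHom (p.preHom f) (p.continuous_preHom f hf) (p.coe a) = f a :=
  UniformSpace.Completion.extensionHom_coe _ (p.continuous_preHom f hf) (p.toPre a)

theorem continuous_extension (f : A →⋆ₐ[ℂ] B) (hf : ∀ a, ‖f a‖ ≤ p a) :
    Continuous (UniformSpace.Completion.extensionHom (p.preHom f) (p.continuous_preHom f hf)) :=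
  UniformSpace.Completion.continuous_extension

end Basic

section CStar

variable {A : Type*} [Ring A] [StarRing A] [Algebra ℂ A] [StarModule ℂ A] (p : CStarSeminorm A)

theorem star_algebraMap (c : ℂ) :
    star (algebraMap ℂ p.Completion c) = algebraMap ℂ p.Completion (star c) :=
  (p.star_coeAlgHom (algebraMap ℂ A c)).trans (congrArg p.coeAlgHom (algebraMap_star_comm c).symm)

instance : StarModule ℂ p.Completion where
  star_smul c x := by
    rw [Algebra.smul_def, star_mul, star_algebraMap, Algebra.smul_def, Algebra.commutes]

instance : CStarAlgebra p.Completion where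

variable {B : Type*} [CStarAlgebra B]

/-- The extension to the completion of a *-homomorphism that is contractive for `p`. -/
def lift (f : A →⋆ₐ[ℂ] B) (hf : ∀ a, ‖f a‖ ≤ p a) : p.Completion →⋆ₐ[ℂ] B where
  __ := UniformSpace.Completion.extensionHom (p.preHom f) (p.continuous_preHom f hf)
  commutes' c :=
    (p.extension_coe f hf (algebraMap ℂ A c)).trans (AlgHomClass.commutes f c)
  map_star' x := by
    have hc := p.continuous_extension f hf
    refine p.induction_on (P := fun x =>
      UniformSpace.Completion.extensionHom (p.preHom f) (p.continuous_preHom f hf) (star x) =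
      star (UniformSpace.Completion.extensionHom (p.preHom f) (p.continuous_preHom f hf) x)) x
      (isClosed_eq (by fun_prop) (by fun_prop)) fun a => ?_
    rw [star_coeAlgHom]
    refine (p.extension_coe f hf (star a)).trans ?_
    rw [StarHomClass.map_star]
    exact congrArg star (p.extension_coe f hf a).symm

theorem lift_coe (f : A →⋆ₐ[ℂ] B) (hf : ∀ a, ‖f a‖ ≤ p a) (a : A) :
    p.lift f hf (p.coe a) = f a :=
  p.extension_coe f hf a

end CStar

end CStarSeminorm

/-! ### Universal C*-algebras given by generators and relations -/

section ScalarStar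

variable (X : Type u)

instance : StarModule ℝ (FreeAlgebra ℝ X) where
  star_smul r a := by simp [Algebra.smul_def, Algebra.commutes]

/-- The free unital complex *-algebra on self-adjoint generators indexed by `X`: complex
noncommutative polynomials, with the conjugate-linear involution that reverses words. -/
abbrev FreeStar : Type u := ℂ ⊗[ℝ] FreeAlgebra ℝ X

instance : StarModule ℂ (FreeStar X) where
  star_smul c a := by
    induction a using TensorProduct.induction_on with
    | zero => simp
    | tmul z w => simp [TensorProduct.smul_tmul']
    | add a b ha hb => simp [smul_add, ha, hb]

end ScalarStar

namespace FreeStar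

variable {X : Type u}

/-- The generator with index `x`. -/
def gen (x : X) : FreeStar X := 1 ⊗ₜ FreeAlgebra.ι ℝ x

theorem star_gen (x : X) : star (gen x) = gen x := by simp [gen]

theorem smul_one_tmul (z : ℂ) (w : FreeAlgebra ℝ X) :
    (z ⊗ₜ[ℝ] w : FreeStar X) = z • ((1 : ℂ) ⊗ₜ[ℝ] w) := by
  simp [TensorProduct.smul_tmul']

theorem induction {P : FreeStar X → Prop} (hg : ∀ x, P (gen x)) (h1 : P 1)
    (hs : ∀ (c : ℂ) a, P a → P (c • a)) (ha : ∀ a b, P a → P b → P (a + b))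
    (hm : ∀ a b, P a → P b → P (a * b)) (a : FreeStar X) : P a := by
  have key : ∀ w : FreeAlgebra ℝ X, P ((1 : ℂ) ⊗ₜ[ℝ] w) := by
    intro w
    induction w using FreeAlgebra.induction with
    | grade0 r =>
      have : ((1 : ℂ) ⊗ₜ[ℝ] algebraMap ℝ (FreeAlgebra ℝ X) r : FreeStar X) = (r : ℂ) • 1 := by
        rw [Algebra.algebraMap_eq_smul_one, TensorProduct.tmul_smul,
          Algebra.TensorProduct.one_def, TensorProduct.smul_tmul', TensorProduct.smul_tmul']
        simp
      rw [this]
      exact hs _ _ h1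
    | grade1 x => exact hg x
    | mul a b iha ihb =>
      have := hm _ _ iha ihb
      rwa [Algebra.TensorProduct.tmul_mul_tmul, one_mul] at this
    | add a b iha ihb =>
      rw [TensorProduct.tmul_add]
      exact ha _ _ iha ihb
  induction a using TensorProduct.induction_on with
  | zero => simpa using hs 0 1 h1
  | tmul z w => rw [smul_one_tmul]; exact hs _ _ (key w)
  | add a b iha ihb => exact ha _ _ iha ihb

variable {B : Type*} [Ring B] [StarRing B] [Algebra ℂ B] [StarModule ℂ B]

/-- Evaluation of noncommutative polynomials at self-adjoint elements of a *-algebra, as an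
algebra homomorphism. -/
def evalAlg (b : X → B) : FreeStar X →ₐ[ℂ] B :=
  letI : Algebra ℝ B := Algebra.compHom B (algebraMap ℝ ℂ)
  haveI : IsScalarTower ℝ ℂ B := IsScalarTower.of_algebraMap_eq fun _ => rfl
  Algebra.TensorProduct.lift (Algebra.ofId ℂ B) (FreeAlgebra.lift ℝ b)
    fun c _ => Algebra.commutes c _

theorem evalAlg_gen (b : X → B) (x : X) : evalAlg b (gen x) = b x := by
  let : Algebra ℝ B := Algebra.compHom B (algebraMap ℝ ℂ)
  have : IsScalarTower ℝ ℂ B := IsScalarTower.of_algebraMap_eq fun _ => rfl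
  refine (Algebra.TensorProduct.lift_tmul (Algebra.ofId ℂ B) (FreeAlgebra.lift ℝ b)
    (fun c _ => Algebra.commutes c _) 1 (FreeAlgebra.ι ℝ x)).trans ?_
  rw [map_one, one_mul, FreeAlgebra.lift_ι_apply]

/-- Evaluation of noncommutative polynomials at self-adjoint elements of a *-algebra. -/
def eval (b : X → B) (hb : ∀ x, star (b x) = b x) : FreeStar X →⋆ₐ[ℂ] B where
  __ := evalAlg b
  map_star' a := by
    change evalAlg b (star a) = star (evalAlg b a)
    induction a using FreeStar.induction with
    | hg x => rw [star_gen, evalAlg_gen, hb]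
    | h1 => simp
    | hs c a h => simp [h]
    | ha a b h1 h2 => simp [h1, h2]
    | hm a b h1 h2 => simp [h1, h2]

theorem eval_gen (b : X → B) (hb : ∀ x, star (b x) = b x) (x : X) : eval b hb (gen x) = b x :=
  evalAlg_gen b x

end FreeStar

/-- The C*-seminorms on the free *-algebra for which the relations `a = b`, `rel a b`, hold. -/
def RelSeminorm {X : Type u} (rel : FreeStar X → FreeStar X → Prop) : Type u :=
  {p : CStarSeminorm (FreeStar X) // ∀ a b, rel a b → p (a - b) = 0}

/-- The relations bound every C*-seminorm, so that a universal C*-algebra exists. -/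
def IsBoundedRel {X : Type u} (rel : FreeStar X → FreeStar X → Prop) : Prop :=
  ∀ a, BddAbove (Set.range fun p : RelSeminorm rel => p.1 a)

/-- The largest C*-seminorm for which the relations hold. -/
def universalSeminorm {X : Type u} (rel : FreeStar X → FreeStar X → Prop)
    (h : IsBoundedRel rel) : CStarSeminorm (FreeStar X) :=
  CStarSeminorm.supr (fun p : RelSeminorm rel => p.1) h

/-- The universal unital C*-algebra with self-adjoint generators indexed by `X` and relations
`a = b` for `rel a b`. -/
def UniversalCStar {X : Type u} (rel : FreeStar X → FreeStar X → Prop)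
    (h : IsBoundedRel rel) : Type u :=
  (universalSeminorm rel h).Completion

namespace UniversalCStar

variable {X : Type u} {rel : FreeStar X → FreeStar X → Prop} (h : IsBoundedRel rel)

instance : CStarAlgebra (UniversalCStar rel h) :=
  inferInstanceAs (CStarAlgebra (universalSeminorm rel h).Completion)

/-- The class of a noncommutative polynomial. -/
def mk : FreeStar X →⋆ₐ[ℂ] UniversalCStar rel h := (universalSeminorm rel h).coe

theorem denseRange_mk : DenseRange (mk h) := (universalSeminorm rel h).denseRange_coe

/-- The generator with index `x`. -/
def gen (x : X) : UniversalCStar rel h := mk h (FreeStar.gen x)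

theorem mk_eq_of_rel {a b : FreeStar X} (hab : rel a b) : mk h a = mk h b := by
  have h0 : universalSeminorm rel h (a - b) = 0 := by
    refine le_antisymm (Real.iSup_le (fun p => (p.2 a b hab).le) le_rfl) ?_
    exact CStarSeminorm.nonneg _ _
  have h1 : ‖mk h (a - b)‖ = 0 := ((universalSeminorm rel h).norm_coe (a - b)).trans h0
  rw [norm_eq_zero, map_sub, sub_eq_zero] at h1
  exact h1

theorem star_gen (x : X) : star (gen h x) = gen h x := by
  rw [gen, ← StarHomClass.map_star, FreeStar.star_gen]

variable {B : Type*} [CStarAlgebra B]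

/-- The universal property: self-adjoint elements that satisfy the relations define a unique
*-homomorphism. -/
def lift (b : X → B) (hb : ∀ x, star (b x) = b x)
    (hrel : ∀ a a', rel a a' → FreeStar.eval b hb a = FreeStar.eval b hb a') :
    UniversalCStar rel h →⋆ₐ[ℂ] B :=
  (universalSeminorm rel h).lift (FreeStar.eval b hb) fun a =>
    CStarSeminorm.le_supr (fun p : RelSeminorm rel => p.1) h
      ⟨CStarSeminorm.ofStarHom (FreeStar.eval b hb), fun a a' haa' => by
        change ‖FreeStar.eval b hb (a - a')‖ = 0
        rw [map_sub, hrel a a' haa', sub_self, norm_zero]⟩ a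

theorem lift_gen (b : X → B) (hb : ∀ x, star (b x) = b x)
    (hrel : ∀ a a', rel a a' → FreeStar.eval b hb a = FreeStar.eval b hb a') (x : X) :
    lift h b hb hrel (gen h x) = b x :=
  ((universalSeminorm rel h).lift_coe _ _ _).trans (FreeStar.eval_gen b hb x)

theorem topologicalClosure_adjoin_gen :
    (StarAlgebra.adjoin ℂ (Set.range (gen h))).topologicalClosure = ⊤ := by
  refine top_le_iff.mp fun x _ => ?_
  have hr : Set.range (mk h) ⊆ (StarAlgebra.adjoin ℂ (Set.range (gen h)) : Set _) := by
    rintro _ ⟨a, rfl⟩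
    induction a using FreeStar.induction with
    | hg x => exact StarAlgebra.subset_adjoin ℂ _ ⟨x, rfl⟩
    | h1 => rw [map_one]; exact one_mem _
    | hs c a ih => rw [map_smul]; exact SMulMemClass.smul_mem c ih
    | ha a b h1 h2 => rw [map_add]; exact add_mem h1 h2
    | hm a b h1 h2 => rw [map_mul]; exact mul_mem h1 h2
  exact closure_mono hr (denseRange_mk h x)

end UniversalCStar

/-- Relations that bound every C*-seminorm on the generators bound it on all elements. -/
theorem isBoundedRel_of_gen {X : Type u} {rel : FreeStar X → FreeStar X → Prop}
    (hg : ∀ x, ∃ C, ∀ p : RelSeminorm rel, p.1 (FreeStar.gen x) ≤ C) : IsBoundedRel rel := by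
  suffices H : ∀ a : FreeStar X, ∃ C, 0 ≤ C ∧ ∀ p : RelSeminorm rel, p.1 a ≤ C by
    intro a
    obtain ⟨C, -, hC⟩ := H a
    exact ⟨C, by rintro _ ⟨p, rfl⟩; exact hC p⟩
  intro a
  induction a using FreeStar.induction with
  | hg x =>
    obtain ⟨C, hC⟩ := hg x
    exact ⟨max C 0, le_max_right _ _, fun p => (hC p).trans (le_max_left _ _)⟩
  | h1 =>
    refine ⟨1, zero_le_one, fun p => ?_⟩
    have := p.1.star_mul_self 1
    rw [star_one, one_mul] at this
    nlinarith [sq_nonneg (p.1 (1 : FreeStar X) - 1)]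
  | hs c a ih =>
    obtain ⟨C, h0, hC⟩ := ih
    refine ⟨‖c‖ * C, by positivity, fun p => ?_⟩
    rw [CStarSeminorm.map_smul]
    exact mul_le_mul_of_nonneg_left (hC p) (norm_nonneg c)
  | ha a b h1 h2 =>
    obtain ⟨C, h0, hC⟩ := h1
    obtain ⟨D, h0', hD⟩ := h2
    exact ⟨C + D, by positivity, fun p => (p.1.add_le a b).trans (add_le_add (hC p) (hD p))⟩
  | hm a b h1 h2 =>
    obtain ⟨C, h0, hC⟩ := h1
    obtain ⟨D, h0', hD⟩ := h2
    exact ⟨C * D, by positivity, fun p =>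
      (p.1.mul_le a b).trans (mul_le_mul (hC p) (hD p) (p.1.nonneg b) h0)⟩

/-! ### The minimal tensor product of C*-algebras -/

section HilbertTensor

variable (H K : Type u) [NormedAddCommGroup H] [InnerProductSpace ℂ H]
  [NormedAddCommGroup K] [InnerProductSpace ℂ K]

/-- The Hilbert space tensor product: the completion of the algebraic tensor product. -/
def HilbertTensor : Type u := UniformSpace.Completion (H ⊗[ℂ] K)

instance : NormedAddCommGroup (HilbertTensor H K) :=
  inferInstanceAs (NormedAddCommGroup (UniformSpace.Completion (H ⊗[ℂ] K)))
instance : InnerProductSpace ℂ (HilbertTensor H K) :=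
  inferInstanceAs (InnerProductSpace ℂ (UniformSpace.Completion (H ⊗[ℂ] K)))
instance : CompleteSpace (HilbertTensor H K) :=
  inferInstanceAs (CompleteSpace (UniformSpace.Completion (H ⊗[ℂ] K)))

namespace HilbertTensor

variable {H K}

/-- The inclusion of the algebraic tensor product. -/
def incl : H ⊗[ℂ] K →ₗᵢ[ℂ] HilbertTensor H K :=
  (UniformSpace.Completion.toComplₗᵢ : H ⊗[ℂ] K →ₗᵢ[ℂ] UniformSpace.Completion (H ⊗[ℂ] K))

theorem denseRange_incl : DenseRange (incl : H ⊗[ℂ] K → HilbertTensor H K) :=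
  UniformSpace.Completion.denseRange_coe (α := H ⊗[ℂ] K)

/-- The elementary tensor `ξ ⊗ η`. -/
def tmul (x : H) (y : K) : HilbertTensor H K := incl (x ⊗ₜ[ℂ] y)

/-- The bounded operator `S ⊗ T` on the Hilbert space tensor product. -/
def map (S : H →L[ℂ] H) (T : K →L[ℂ] K) : HilbertTensor H K →L[ℂ] HilbertTensor H K :=
  ((TensorProduct.mapL S T).completion :
    UniformSpace.Completion (H ⊗[ℂ] K) →L[ℂ] UniformSpace.Completion (H ⊗[ℂ] K))

theorem map_incl (S : H →L[ℂ] H) (T : K →L[ℂ] K) (x : H ⊗[ℂ] K) :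
    map S T (incl x) = incl (TensorProduct.mapL S T x) :=
  ContinuousLinearMap.completion_apply_coe (TensorProduct.mapL S T) x

theorem map_tmul (S : H →L[ℂ] H) (T : K →L[ℂ] K) (x : H) (y : K) :
    map S T (tmul x y) = tmul (S x) (T y) := map_incl S T _

theorem op_ext {S T : HilbertTensor H K →L[ℂ] HilbertTensor H K}
    (h : ∀ x y, S (tmul x y) = T (tmul x y)) : S = T := by
  ext x
  refine congrFun (denseRange_incl.equalizer S.continuous T.continuous (funext fun x => ?_)) x
  simp only [Function.comp_apply]
  induction x using TensorProduct.induction_on with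
  | zero => rw [map_zero, map_zero, map_zero]
  | tmul x y => exact h x y
  | add x y hx hy => rw [map_add, map_add, map_add, hx, hy]

theorem tmul_add (x : H) (y y' : K) : tmul x (y + y') = tmul x y + tmul x y' := by
  rw [tmul, TensorProduct.tmul_add, map_add]; rfl

theorem add_tmul (x x' : H) (y : K) : tmul (x + x') y = tmul x y + tmul x' y := by
  rw [tmul, TensorProduct.add_tmul, map_add]; rfl

theorem tmul_smul (c : ℂ) (x : H) (y : K) : tmul x (c • y) = c • tmul x y := by
  rw [tmul, TensorProduct.tmul_smul, map_smul]; rfl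

theorem smul_tmul (c : ℂ) (x : H) (y : K) : tmul (c • x) y = c • tmul x y := by
  rw [tmul, ← TensorProduct.smul_tmul', map_smul]; rfl

theorem inner_tmul (x x' : H) (y y' : K) :
    inner ℂ (tmul x y) (tmul x' y') = inner ℂ x x' * inner ℂ y y' :=
  (incl.inner_map_map _ _).trans (TensorProduct.inner_tmul ℂ x x' y y')

theorem norm_map_le (S : H →L[ℂ] H) (T : K →L[ℂ] K) : ‖map S T‖ ≤ ‖S‖ * ‖T‖ := by
  refine ContinuousLinearMap.opNorm_le_bound _ (by positivity) fun x => ?_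
  refine denseRange_incl.induction_on (p := fun x => ‖map S T x‖ ≤ ‖S‖ * ‖T‖ * ‖x‖) x
    (isClosed_le (by fun_prop) (by fun_prop)) fun x => ?_
  rw [map_incl, LinearIsometry.norm_map, LinearIsometry.norm_map]
  exact ((TensorProduct.mapL S T).le_opNorm x).trans
    (mul_le_mul_of_nonneg_right (TensorProduct.norm_mapL_le S T) (norm_nonneg x))

theorem star_map [CompleteSpace H] [CompleteSpace K] (S : H →L[ℂ] H) (T : K →L[ℂ] K) :
    star (map S T) = map (star S) (star T) := by
  refine ((ContinuousLinearMap.eq_adjoint_iff (map (star S) (star T)) (map S T)).mpr ?_).symm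
  intro x y
  refine denseRange_incl.induction_on₂
    (p := fun x y => inner ℂ (map (star S) (star T) x) y = inner ℂ x (map S T y))
    (isClosed_eq (by fun_prop) (by fun_prop)) (fun x y => ?_) x y
  induction x using TensorProduct.induction_on with
  | zero => rw [map_zero, map_zero, inner_zero_left, inner_zero_left]
  | add x x' hx hx' => rw [map_add, map_add, inner_add_left, inner_add_left, hx, hx']
  | tmul h k =>
    induction y using TensorProduct.induction_on with
    | zero => rw [map_zero, map_zero, inner_zero_right, inner_zero_right]
    | add x x' hx hx' => rw [map_add, map_add, inner_add_right, inner_add_right, hx, hx']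
    | tmul h' k' =>
      change inner ℂ (map _ _ (tmul h k)) (tmul h' k') = inner ℂ (tmul h k) (map _ _ (tmul h' k'))
      rw [map_tmul, map_tmul, inner_tmul, inner_tmul, ContinuousLinearMap.star_eq_adjoint,
        ContinuousLinearMap.star_eq_adjoint, ContinuousLinearMap.adjoint_inner_left,
        ContinuousLinearMap.adjoint_inner_left]

end HilbertTensor

end HilbertTensor

section MinTensor

/-- A pair of representations, of `A` and of `B`, on Hilbert spaces. -/
structure RepPair (A B : Type u) [CStarAlgebra A] [CStarAlgebra B] where
  H : Type u
  K : Type u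
  [groupH : NormedAddCommGroup H]
  [innerH : InnerProductSpace ℂ H]
  [completeH : CompleteSpace H]
  [groupK : NormedAddCommGroup K]
  [innerK : InnerProductSpace ℂ K]
  [completeK : CompleteSpace K]
  π : A →⋆ₐ[ℂ] (H →L[ℂ] H)
  ρ : B →⋆ₐ[ℂ] (K →L[ℂ] K)

namespace RepPair

attribute [instance] groupH innerH completeH groupK innerK completeK

variable {A B : Type u} [CStarAlgebra A] [CStarAlgebra B] (r : RepPair A B)

/-- The representation `π ⊗ ρ` on the Hilbert space tensor product, as an algebra homomorphism. -/
def tensorAlgHom : A ⊗[ℂ] B →ₐ[ℂ] (HilbertTensor r.H r.K →L[ℂ] HilbertTensor r.H r.K) :=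
  Algebra.TensorProduct.algHomOfLinearMapTensorProduct
    (TensorProduct.lift (LinearMap.mk₂ ℂ (fun a b => HilbertTensor.map (r.π a) (r.ρ b))
      (fun a a' b => HilbertTensor.op_ext fun x y => by
        simp [HilbertTensor.map_tmul, HilbertTensor.add_tmul])
      (fun c a b => HilbertTensor.op_ext fun x y => by
        simp [HilbertTensor.map_tmul, HilbertTensor.smul_tmul])
      (fun a b b' => HilbertTensor.op_ext fun x y => by
        simp [HilbertTensor.map_tmul, HilbertTensor.tmul_add])
      (fun c a b => HilbertTensor.op_ext fun x y => by
        simp [HilbertTensor.map_tmul, HilbertTensor.tmul_smul])))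
    (fun a a' b b' => HilbertTensor.op_ext fun x y => by simp [HilbertTensor.map_tmul])
    (HilbertTensor.op_ext fun x y => by simp [HilbertTensor.map_tmul])

/-- The representation `π ⊗ ρ` of the algebraic tensor product on the Hilbert space tensor product,
with `(π ⊗ ρ) (a ⊗ b) = π a ⊗ ρ b`. -/
def tensorRep : A ⊗[ℂ] B →⋆ₐ[ℂ] (HilbertTensor r.H r.K →L[ℂ] HilbertTensor r.H r.K) where
  __ := r.tensorAlgHom
  map_star' x := by
    change r.tensorAlgHom (star x) = star (r.tensorAlgHom x)
    induction x using TensorProduct.induction_on with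
    | zero => simp
    | add x y hx hy => simp [hx, hy]
    | tmul a b =>
      change HilbertTensor.map (r.π (star a)) (r.ρ (star b)) =
        star (HilbertTensor.map (r.π a) (r.ρ b))
      rw [HilbertTensor.star_map, StarHomClass.map_star, StarHomClass.map_star]

theorem tensorRep_tmul (a : A) (b : B) :
    r.tensorRep (a ⊗ₜ b) = HilbertTensor.map (r.π a) (r.ρ b) := rfl

/-- The C*-seminorm `x ↦ ‖(π ⊗ ρ) x‖` on the algebraic tensor product. -/
def seminorm : CStarSeminorm (A ⊗[ℂ] B) := CStarSeminorm.ofStarHom r.tensorRep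

end RepPair

variable (A B : Type u) [CStarAlgebra A] [CStarAlgebra B]

theorem bddAbove_repPair (x : A ⊗[ℂ] B) :
    BddAbove (Set.range fun r : RepPair A B => r.seminorm x) := by
  suffices H : ∃ C, ∀ r : RepPair A B, ‖r.tensorRep x‖ ≤ C by
    obtain ⟨C, hC⟩ := H
    exact ⟨C, by rintro _ ⟨r, rfl⟩; exact hC r⟩
  induction x using TensorProduct.induction_on with
  | zero => exact ⟨0, fun r => by simp⟩
  | tmul a b =>
    refine ⟨‖a‖ * ‖b‖, fun r => ?_⟩
    rw [RepPair.tensorRep_tmul]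
    refine (HilbertTensor.norm_map_le _ _).trans ?_
    gcongr
    · exact NonUnitalStarAlgHom.norm_apply_le r.π a
    · exact NonUnitalStarAlgHom.norm_apply_le r.ρ b
  | add x y hx hy =>
    obtain ⟨C, hC⟩ := hx
    obtain ⟨D, hD⟩ := hy
    refine ⟨C + D, fun r => ?_⟩
    rw [map_add]
    exact (norm_add_le _ _).trans (add_le_add (hC r) (hD r))

/-- The minimal (spatial) C*-norm on the algebraic tensor product: the supremum of
`‖(π ⊗ ρ) x‖` over all representations `π` of `A` and `ρ` of `B` on Hilbert spaces. -/
def minSeminorm : CStarSeminorm (A ⊗[ℂ] B) :=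
  CStarSeminorm.supr (fun r : RepPair A B => r.seminorm) (bddAbove_repPair A B)

/-- The minimal tensor product of two unital C*-algebras. -/
def MinTensor : Type u := (minSeminorm A B).Completion

instance : CStarAlgebra (MinTensor A B) :=
  inferInstanceAs (CStarAlgebra (minSeminorm A B).Completion)

namespace MinTensor

variable {A B}

/-- The canonical map of the algebraic tensor product into the minimal tensor product. -/
def ofAlg : A ⊗[ℂ] B →⋆ₐ[ℂ] MinTensor A B := (minSeminorm A B).coe

/-- The elementary tensor `a ⊗ b`. -/
def tmul (a : A) (b : B) : MinTensor A B := ofAlg (a ⊗ₜ b)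

theorem tmul_mul_tmul (a a' : A) (b b' : B) :
    tmul a b * tmul a' b' = tmul (a * a') (b * b') := by
  rw [tmul, tmul, ← map_mul, Algebra.TensorProduct.tmul_mul_tmul]; rfl

theorem star_tmul (a : A) (b : B) : star (tmul a b) = tmul (star a) (star b) := by
  rw [tmul, ← StarHomClass.map_star]; rfl

theorem one_tmul_one : tmul (1 : A) (1 : B) = 1 := map_one ofAlg

theorem zero_tmul (b : B) : tmul (0 : A) b = 0 := by
  rw [tmul, TensorProduct.zero_tmul, map_zero]

theorem tmul_zero (a : A) : tmul a (0 : B) = 0 := by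
  rw [tmul, TensorProduct.tmul_zero, map_zero]

theorem sum_tmul {ι : Type*} (s : Finset ι) (f : ι → A) (b : B) :
    tmul (∑ i ∈ s, f i) b = ∑ i ∈ s, tmul (f i) b := by
  rw [tmul, TensorProduct.sum_tmul, map_sum]; rfl

theorem tmul_sum {ι : Type*} (s : Finset ι) (a : A) (f : ι → B) :
    tmul a (∑ i ∈ s, f i) = ∑ i ∈ s, tmul a (f i) := by
  rw [tmul, TensorProduct.tmul_sum, map_sum]; rfl

variable {A' B' : Type u} [CStarAlgebra A'] [CStarAlgebra B']

/-- The tensor product of two *-homomorphisms, on the algebraic tensor product. -/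
def mapAlg (φ : A →⋆ₐ[ℂ] A') (ψ : B →⋆ₐ[ℂ] B') : A ⊗[ℂ] B →⋆ₐ[ℂ] A' ⊗[ℂ] B' where
  __ := Algebra.TensorProduct.map φ.toAlgHom ψ.toAlgHom
  map_star' x := by
    change Algebra.TensorProduct.map φ.toAlgHom ψ.toAlgHom (star x) =
      star (Algebra.TensorProduct.map φ.toAlgHom ψ.toAlgHom x)
    induction x using TensorProduct.induction_on with
    | zero => simp
    | tmul a b => simp [StarHomClass.map_star]
    | add x y hx hy => simp [hx, hy]

/-- Representations are pulled back along *-homomorphisms. -/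
def _root_.RepPair.comap (r : RepPair A' B') (φ : A →⋆ₐ[ℂ] A') (ψ : B →⋆ₐ[ℂ] B') :
    RepPair A B where
  H := r.H
  K := r.K
  π := r.π.comp φ
  ρ := r.ρ.comp ψ

theorem tensorRep_mapAlg (r : RepPair A' B') (φ : A →⋆ₐ[ℂ] A') (ψ : B →⋆ₐ[ℂ] B')
    (x : A ⊗[ℂ] B) : r.tensorRep (mapAlg φ ψ x) = (r.comap φ ψ).tensorRep x := by
  induction x using TensorProduct.induction_on with
  | zero => rw [map_zero, map_zero, map_zero]; rfl
  | tmul a b => rfl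
  | add x y hx hy => rw [map_add, map_add, map_add, hx, hy]; rfl

/-- The *-homomorphism `φ ⊗ ψ` between minimal tensor products, with
`(φ ⊗ ψ) (a ⊗ b) = φ a ⊗ ψ b`. -/
def map (φ : A →⋆ₐ[ℂ] A') (ψ : B →⋆ₐ[ℂ] B') : MinTensor A B →⋆ₐ[ℂ] MinTensor A' B' :=
  (minSeminorm A B).lift (ofAlg.comp (mapAlg φ ψ)) fun x => by
    change ‖(minSeminorm A' B').coe (mapAlg φ ψ x)‖ ≤ _
    rw [CStarSeminorm.norm_coe]
    refine Real.iSup_le (fun r => ?_) (CStarSeminorm.nonneg _ _)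
    change ‖r.tensorRep (mapAlg φ ψ x)‖ ≤ _
    rw [tensorRep_mapAlg]
    exact CStarSeminorm.le_supr _ (bddAbove_repPair A B) (r.comap φ ψ) x

theorem map_tmul (φ : A →⋆ₐ[ℂ] A') (ψ : B →⋆ₐ[ℂ] B') (a : A) (b : B) :
    map φ ψ (tmul a b) = tmul (φ a) (ψ b) :=
  (minSeminorm A B).lift_coe _ _ _

end MinTensor

end MinTensor

/-! ### Compact matrix quantum groups -/

/-- A compact matrix quantum group: a unital C*-algebra `C`, generated by the entries of a matrix
`u` such that `u` and its transpose are invertible and such that `u i j ↦ ∑ k, u i k ⊗ u k j`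
extends to a *-homomorphism `comul : C → C ⊗ C`. -/
structure CompactMatrixQuantumGroup (ι : Type u) [Fintype ι] [DecidableEq ι] where
  C : Type u
  [cstar : CStarAlgebra C]
  u : Matrix ι ι C
  generates : (StarAlgebra.adjoin ℂ (Set.range fun p : ι × ι => u p.1 p.2)).topologicalClosure = ⊤
  comul : C →⋆ₐ[ℂ] MinTensor C C
  comul_u : ∀ i j, comul (u i j) = ∑ k, MinTensor.tmul (u i k) (u k j)
  isUnit_u : IsUnit u
  isUnit_transpose : IsUnit u.transpose

attribute [instance] CompactMatrixQuantumGroup.cstar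

/-- Isomorphism of compact quantum groups: a *-isomorphism `φ` of the C*-algebras such that
`Δ (φ a) = (φ ⊗ φ) (Δ a)`. -/
def CompactMatrixQuantumGroup.IsIsomorphic {ι κ : Type u} [Fintype ι] [DecidableEq ι] [Fintype κ]
    [DecidableEq κ] (𝔾 : CompactMatrixQuantumGroup ι) (ℍ : CompactMatrixQuantumGroup κ) : Prop :=
  ∃ φ : 𝔾.C ≃⋆ₐ[ℂ] ℍ.C, ∀ a,
    ℍ.comul (φ a) = MinTensor.map (φ : 𝔾.C →⋆ₐ[ℂ] ℍ.C) (φ : 𝔾.C →⋆ₐ[ℂ] ℍ.C) (𝔾.comul a)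

/-! ### Colored graphs -/

/-- A vertex- and edge-colored simple graph. Only the values of `ecolor` on edges matter. -/
structure ColoredGraph (V CV CE : Type*) where
  graph : SimpleGraph V
  vcolor : V → CV
  ecolor : Sym2 V → CE

/-- An uncolored graph: all vertices, and all edges, have the same color. -/
def ColoredGraph.ofGraph {V : Type*} (G : SimpleGraph V) : ColoredGraph V Unit Unit where
  graph := G
  vcolor _ := ()
  ecolor _ := ()

namespace ColoredGraph

variable {V CV CE : Type*} (G : ColoredGraph V CV CE)

/-- `i` and `j` are joined by an edge of color `c`. -/
def IsEdge (c : CE) (i j : V) : Prop := G.graph.Adj i j ∧ G.ecolor s(i, j) = c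

theorem isEdge_symm {c : CE} {i j : V} (h : G.IsEdge c i j) : G.IsEdge c j i :=
  ⟨h.1.symm, by rw [Sym2.eq_swap]; exact h.2⟩

open Classical in
/-- The adjacency matrix of the edge color `c`. -/
def adjMatrix (R : Type*) [Zero R] [One R] (c : CE) : Matrix V V R :=
  Matrix.of fun i j => if G.IsEdge c i j then 1 else 0

/-- Attach to every vertex `v` of color `c` a path of length `n c`, forget the vertex colors, and
give the edges of these paths the color `c₀`. The vertex `(v, 0)` is the vertex `v` of `G`, and
`(v, i)` is the vertex at distance `i` from it on the path attached at `v`. -/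
def attachPaths (n : CV → ℕ) (c₀ : CE) :
    ColoredGraph (Σ v : V, Fin (n (G.vcolor v) + 1)) Unit CE where
  graph :=
    { Adj := fun x y => (G.graph.Adj x.1 y.1 ∧ (x.2 : ℕ) = 0 ∧ (y.2 : ℕ) = 0) ∨
        (x.1 = y.1 ∧ ((x.2 : ℕ) + 1 = y.2 ∨ (y.2 : ℕ) + 1 = x.2))
      symm := ⟨fun x y h => h.imp (fun h => ⟨h.1.symm, h.2.2, h.2.1⟩) fun h => ⟨h.1.symm, h.2.symm⟩⟩
      loopless := ⟨fun x h => h.elim (fun h => G.graph.loopless.irrefl _ h.1) (by omega)⟩ }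
  vcolor _ := ()
  ecolor :=
    open Classical in
    fun e => if e.map Sigma.fst ∈ G.graph.edgeSet then G.ecolor (e.map Sigma.fst) else c₀

/-- The edges whose color is not `c₀`. -/
def SubdividedEdge (c₀ : CE) : Type _ := {e : Sym2 V // e ∈ G.graph.edgeSet ∧ G.ecolor e ≠ c₀}

instance [Finite V] (c₀ : CE) : Finite (G.SubdividedEdge c₀) :=
  inferInstanceAs (Finite {e : Sym2 V // e ∈ G.graph.edgeSet ∧ G.ecolor e ≠ c₀})

instance [Finite V] (c₀ : CE) : Fintype (G.SubdividedEdge c₀) := Fintype.ofFinite _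

instance (c₀ : CE) : DecidableEq (G.SubdividedEdge c₀) := Classical.decEq _

/-- Subdivide every edge `e` whose color `c` is not `c₀`, attach a path of length `m c` to the new
vertex, and forget all colors. The vertex `(e, 0)` is the vertex that subdivides `e`, and `(e, i)`
is the vertex at distance `i` from it on the attached path. -/
def subdivide (c₀ : CE) (m : CE → ℕ) :
    SimpleGraph (V ⊕ Σ e : G.SubdividedEdge c₀, Fin (m (G.ecolor e.1) + 1)) where
  Adj
    | .inl x, .inl y => G.IsEdge c₀ x y
    | .inl x, .inr p => x ∈ p.1.1 ∧ (p.2 : ℕ) = 0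
    | .inr p, .inl x => x ∈ p.1.1 ∧ (p.2 : ℕ) = 0
    | .inr p, .inr q => p.1 = q.1 ∧ ((p.2 : ℕ) + 1 = q.2 ∨ (q.2 : ℕ) + 1 = p.2)
  symm := ⟨by
    rintro (x | p) (y | q) h
    · exact G.isEdge_symm h
    · exact h
    · exact h
    · exact ⟨h.1.symm, h.2.symm⟩⟩
  loopless := ⟨by
    rintro (x | p) h
    · exact G.graph.loopless.irrefl _ h.1
    · rcases h with ⟨-, h | h⟩ <;> omega⟩

end ColoredGraph

/-! ### Quantum automorphism groups -/

section Qut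

variable {V : Type u} [Fintype V] {CV CE : Type*} (G : ColoredGraph V CV CE)

/-- The matrix of generators. -/
def genMatrix (V : Type u) : Matrix V V (FreeStar (V × V)) :=
  Matrix.of fun i j => FreeStar.gen (i, j)

/-- The defining relations of the quantum automorphism group of a colored graph, for self-adjoint
generators `u i j`. -/
inductive QutRel : FreeStar (V × V) → FreeStar (V × V) → Prop
  | idem (i j : V) : QutRel (genMatrix V i j * genMatrix V i j) (genMatrix V i j)
  | row (i : V) : QutRel (∑ l, genMatrix V i l) 1
  | col (i : V) : QutRel (∑ l, genMatrix V l i) 1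
  | vertexColor (i j : V) (h : G.vcolor i ≠ G.vcolor j) : QutRel (genMatrix V i j) 0
  | edgeColor (c : CE) (i j : V) :
      QutRel ((G.adjMatrix (FreeStar (V × V)) c * genMatrix V) i j)
        ((genMatrix V * G.adjMatrix (FreeStar (V × V)) c) i j)

/-- The relations above, together with `u i k * u j l = u j l * u i k` whenever `(i, j)` and
`(k, l)` are edges of the same color `c ≠ c₀`. -/
inductive QutStarRel (c₀ : CE) : FreeStar (V × V) → FreeStar (V × V) → Prop
  | qut (a b : FreeStar (V × V)) (h : QutRel G a b) : QutStarRel c₀ a b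
  | comm (c : CE) (hc : c ≠ c₀) (i j k l : V) (hij : G.IsEdge c i j) (hkl : G.IsEdge c k l) :
      QutStarRel c₀ (genMatrix V i k * genMatrix V j l) (genMatrix V j l * genMatrix V i k)

theorem isBoundedRel_of_idem {rel : FreeStar (V × V) → FreeStar (V × V) → Prop}
    (h : ∀ a b, QutRel G a b → rel a b) : IsBoundedRel rel := by
  refine isBoundedRel_of_gen fun x => ⟨1, fun p => ?_⟩
  have h0 : p.1 (FreeStar.gen x * FreeStar.gen x - FreeStar.gen x) = 0 :=
    p.2 _ _ (h _ _ (QutRel.idem x.1 x.2))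
  have h1 : p.1 (star (FreeStar.gen x) * FreeStar.gen x) ≤ p.1 (FreeStar.gen x) := by
    rw [FreeStar.star_gen]
    calc _ = p.1 ((FreeStar.gen x * FreeStar.gen x - FreeStar.gen x) + FreeStar.gen x) := by
          rw [sub_add_cancel]
      _ ≤ _ := (p.1.add_le _ _).trans (by rw [h0, zero_add])
  rw [p.1.star_mul_self] at h1
  nlinarith [p.1.nonneg (FreeStar.gen x)]

/-- A matrix over a C*-algebra that satisfies the relations of the quantum automorphism group. -/
structure IsQutMatrix {B : Type*} [CStarAlgebra B] (w : Matrix V V B) : Prop where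
  star_eq : ∀ i j, star (w i j) = w i j
  idem : ∀ i j, w i j * w i j = w i j
  row : ∀ i, ∑ l, w i l = 1
  col : ∀ i, ∑ l, w l i = 1
  vertexColor : ∀ i j, G.vcolor i ≠ G.vcolor j → w i j = 0
  edgeColor : ∀ c, G.adjMatrix B c * w = w * G.adjMatrix B c

/-- The commutation relations along edges of the same color other than `c₀`. -/
def EdgeCommute {B : Type*} [Mul B] (c₀ : CE) (w : Matrix V V B) : Prop :=
  ∀ c, c ≠ c₀ → ∀ i j k l, G.IsEdge c i j → G.IsEdge c k l → w i k * w j l = w j l * w i k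

section Lemmas

variable {B : Type*} [CStarAlgebra B]

theorem proj_orthogonal {ι : Type*} [Fintype ι] (p : ι → B) (hs : ∀ i, star (p i) = p i)
    (hi : ∀ i, p i * p i = p i) (h1 : ∑ i, p i = 1) {i j : ι} (hij : i ≠ j) : p i * p j = 0 := by
  classical
  let _ : PartialOrder B := CStarAlgebra.spectralOrder B
  have _ : StarOrderedRing B := CStarAlgebra.spectralOrderedRing B
  have hsum : ∑ k ∈ Finset.univ.erase j, star (p k * p j) * (p k * p j) = 0 := by
    have h2 : ∀ k, star (p k * p j) * (p k * p j) = p j * p k * p j := fun k => by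
      rw [star_mul, hs, hs, mul_assoc, ← mul_assoc (p k), hi, mul_assoc]
    have h3 : ∑ k, star (p k * p j) * (p k * p j) = p j := by
      simp_rw [h2]
      rw [← Finset.sum_mul, ← Finset.mul_sum, h1, mul_one, hi]
    have h4 := Finset.add_sum_erase Finset.univ
      (fun k => star (p k * p j) * (p k * p j)) (Finset.mem_univ j)
    rw [h3] at h4
    simp only [hi, hs] at h4
    exact add_eq_left.mp h4
  have := (Finset.sum_eq_zero_iff_of_nonneg
    (fun k _ => star_mul_self_nonneg (p k * p j))).mp hsum i
    (Finset.mem_erase.mpr ⟨hij, Finset.mem_univ i⟩)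
  exact CStarRing.star_mul_self_eq_zero_iff _ |>.mp this

variable {G}

namespace IsQutMatrix

variable {w : Matrix V V B}

theorem row_orthogonal (hw : IsQutMatrix G w) (i : V) {j k : V} (h : j ≠ k) :
    w i j * w i k = 0 :=
  proj_orthogonal (fun l => w i l) (hw.star_eq i) (hw.idem i) (hw.row i) h

theorem col_orthogonal (hw : IsQutMatrix G w) (i : V) {j k : V} (h : j ≠ k) :
    w j i * w k i = 0 :=
  proj_orthogonal (fun l => w l i) (fun l => hw.star_eq l i) (fun l => hw.idem l i) (hw.col i) h

theorem mul_eq_zero_of_isEdge (hw : IsQutMatrix G w) {c : CE} {i j a b : V}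
    (hij : G.IsEdge c i j) (hab : ¬ G.IsEdge c a b) : w i a * w j b = 0 := by
  classical
  have h := congrFun (congrFun (hw.edgeColor c) i) b
  simp only [Matrix.mul_apply, ColoredGraph.adjMatrix, Matrix.of_apply, ite_mul, one_mul, zero_mul,
    mul_ite, mul_one, mul_zero] at h
  have h2 := congrArg (fun x => w i a * x * w j b) h
  simp only [Finset.mul_sum, Finset.sum_mul] at h2
  rw [Finset.sum_eq_single j, Finset.sum_eq_zero] at h2
  · rwa [if_pos hij, mul_assoc, hw.idem] at h2
  · intro k _
    split_ifs with hk
    · have : a ≠ k := by rintro rfl; exact hab hk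
      rw [hw.row_orthogonal i this, zero_mul]
    · rw [mul_zero, zero_mul]
  · intro k _ hk
    split_ifs
    · rw [mul_assoc, hw.col_orthogonal b hk, mul_zero]
    · rw [mul_zero, zero_mul]
  · simp

theorem mul_transpose [DecidableEq V] (hw : IsQutMatrix G w) : w * w.transpose = 1 := by
  ext i j
  rw [Matrix.mul_apply]
  simp only [Matrix.transpose_apply]
  by_cases h : i = j
  · subst h; simp [hw.idem, hw.row]
  · rw [Matrix.one_apply_ne h]
    exact Finset.sum_eq_zero fun k _ => hw.col_orthogonal k h

theorem transpose_mul [DecidableEq V] (hw : IsQutMatrix G w) : w.transpose * w = 1 := by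
  ext i j
  rw [Matrix.mul_apply]
  simp only [Matrix.transpose_apply]
  by_cases h : i = j
  · subst h; simp [hw.idem, hw.col]
  · rw [Matrix.one_apply_ne h]
    exact Finset.sum_eq_zero fun k _ => hw.row_orthogonal k h

theorem isUnit [DecidableEq V] (hw : IsQutMatrix G w) : IsUnit w :=
  ⟨⟨w, w.transpose, hw.mul_transpose, hw.transpose_mul⟩, rfl⟩

theorem isUnit_transpose [DecidableEq V] (hw : IsQutMatrix G w) : IsUnit w.transpose :=
  ⟨⟨w.transpose, w, hw.transpose_mul, hw.mul_transpose⟩, rfl⟩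

end IsQutMatrix

/-- The matrix with entries `∑ k, w i k ⊗ w k j`. -/
def tensorMatrix {B : Type u} [CStarAlgebra B] (w : Matrix V V B) :
    Matrix V V (MinTensor B B) :=
  Matrix.of fun i j => ∑ k, MinTensor.tmul (w i k) (w k j)

theorem tensorMatrix_apply {B : Type u} [CStarAlgebra B] (w : Matrix V V B) (i j : V) :
    tensorMatrix w i j = ∑ k, MinTensor.tmul (w i k) (w k j) := rfl

theorem isQutMatrix_tensorMatrix {B : Type u} [CStarAlgebra B] {w : Matrix V V B}
    (hw : IsQutMatrix G w) : IsQutMatrix G (tensorMatrix w) where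
  star_eq i j := by simp [tensorMatrix_apply, MinTensor.star_tmul, hw.star_eq]
  idem i j := by
    simp only [tensorMatrix_apply, Finset.sum_mul, Finset.mul_sum, MinTensor.tmul_mul_tmul]
    refine Finset.sum_congr rfl fun k _ => ?_
    rw [Finset.sum_eq_single k, hw.idem, hw.idem]
    · intro l _ hl
      rw [hw.row_orthogonal i hl, MinTensor.zero_tmul]
    · simp
  row i := by
    simp only [tensorMatrix_apply]
    rw [Finset.sum_comm]
    simp only [← MinTensor.tmul_sum, ← MinTensor.sum_tmul, hw.row, MinTensor.one_tmul_one]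
  col i := by
    simp only [tensorMatrix_apply]
    rw [Finset.sum_comm]
    simp only [← MinTensor.tmul_sum, ← MinTensor.sum_tmul, hw.col, MinTensor.one_tmul_one]
  vertexColor i j h := by
    rw [tensorMatrix_apply]
    refine Finset.sum_eq_zero fun k _ => ?_
    by_cases hk : G.vcolor i = G.vcolor k
    · rw [hw.vertexColor k j (hk ▸ h), MinTensor.tmul_zero]
    · rw [hw.vertexColor i k hk, MinTensor.zero_tmul]
  edgeColor c := by
    classical
    have h1 : ∀ i b, ∑ j, (if G.IsEdge c i j then w j b else 0) =
        ∑ a, (if G.IsEdge c a b then w i a else 0) := fun i b => by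
      have h := congrFun (congrFun (hw.edgeColor c) i) b
      simpa only [Matrix.mul_apply, ColoredGraph.adjMatrix, Matrix.of_apply, ite_mul, one_mul,
        zero_mul, mul_ite, mul_one, mul_zero] using h
    have t0 : ∀ (P : Prop) [Decidable P] (a b : B), (if P then MinTensor.tmul a b else 0) =
        MinTensor.tmul (if P then a else 0) b := fun P _ a b => by
      split_ifs
      · rfl
      · exact (MinTensor.zero_tmul b).symm
    have t1 : ∀ (P : Prop) [Decidable P] (a b : B), (if P then MinTensor.tmul a b else 0) =
        MinTensor.tmul a (if P then b else 0) := fun P _ a b => by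
      split_ifs
      · rfl
      · exact (MinTensor.tmul_zero a).symm
    have s0 : ∀ (P : Prop) [Decidable P] (f : V → MinTensor B B),
        (if P then ∑ k, f k else 0) = ∑ k, if P then f k else 0 := fun P _ f => by
      split_ifs <;> simp
    ext i b
    simp only [Matrix.mul_apply, ColoredGraph.adjMatrix, Matrix.of_apply, ite_mul, one_mul,
      zero_mul, mul_ite, mul_one, mul_zero, tensorMatrix_apply, s0]
    rw [Finset.sum_comm]
    conv_rhs => rw [Finset.sum_comm]
    simp only [t0]
    simp only [← MinTensor.sum_tmul, h1]
    simp only [MinTensor.sum_tmul, ← t0]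
    simp only [t1]
    rw [Finset.sum_comm]
    simp only [← MinTensor.tmul_sum, h1]

theorem edgeCommute_tensorMatrix {B : Type u} [CStarAlgebra B] {c₀ : CE} {w : Matrix V V B}
    (hw : IsQutMatrix G w) (hc : EdgeCommute G c₀ w) : EdgeCommute G c₀ (tensorMatrix w) := by
  intro c hcc i j k l hij hkl
  simp only [tensorMatrix_apply, Finset.sum_mul, Finset.mul_sum, MinTensor.tmul_mul_tmul]
  rw [Finset.sum_comm]
  refine Finset.sum_congr rfl fun a _ => Finset.sum_congr rfl fun b _ => ?_
  by_cases hab : G.IsEdge c a b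
  · rw [hc c hcc i j a b hij hab, hc c hcc a b k l hab hkl]
  · have h2 : ¬ G.IsEdge c b a := fun h => hab (G.isEdge_symm h)
    rw [hw.mul_eq_zero_of_isEdge hij hab, hw.mul_eq_zero_of_isEdge (G.isEdge_symm hij) h2,
      MinTensor.zero_tmul, MinTensor.zero_tmul]

theorem eval_adjMatrix_mul (w : Matrix V V B) (hs : ∀ p : V × V, star (w p.1 p.2) = w p.1 p.2)
    (c : CE) (i j : V) : FreeStar.eval (fun p : V × V => w p.1 p.2) hs
      ((G.adjMatrix (FreeStar (V × V)) c * genMatrix V) i j) = (G.adjMatrix B c * w) i j := by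
  simp [Matrix.mul_apply, ColoredGraph.adjMatrix, genMatrix, FreeStar.eval_gen, apply_ite]

theorem eval_mul_adjMatrix (w : Matrix V V B) (hs : ∀ p : V × V, star (w p.1 p.2) = w p.1 p.2)
    (c : CE) (i j : V) : FreeStar.eval (fun p : V × V => w p.1 p.2) hs
      ((genMatrix V * G.adjMatrix (FreeStar (V × V)) c) i j) = (w * G.adjMatrix B c) i j := by
  simp [Matrix.mul_apply, ColoredGraph.adjMatrix, genMatrix, FreeStar.eval_gen, apply_ite]

theorem IsQutMatrix.eval_eq {w : Matrix V V B} (hw : IsQutMatrix G w)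
    {a b : FreeStar (V × V)} (h : QutRel G a b) :
    FreeStar.eval (fun p : V × V => w p.1 p.2) (fun p => hw.star_eq p.1 p.2) a =
      FreeStar.eval (fun p : V × V => w p.1 p.2) (fun p => hw.star_eq p.1 p.2) b := by
  cases h with
  | idem i j => simp [genMatrix, FreeStar.eval_gen, hw.idem]
  | row i => simp [genMatrix, FreeStar.eval_gen, hw.row]
  | col i => simp [genMatrix, FreeStar.eval_gen, hw.col]
  | vertexColor i j h => simp [genMatrix, FreeStar.eval_gen, hw.vertexColor i j h]
  | edgeColor c i j => rw [eval_adjMatrix_mul, eval_mul_adjMatrix, hw.edgeColor]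

theorem IsQutMatrix.eval_eq_of_star {c₀ : CE} {w : Matrix V V B} (hw : IsQutMatrix G w)
    (hc : EdgeCommute G c₀ w) {a b : FreeStar (V × V)} (h : QutStarRel G c₀ a b) :
    FreeStar.eval (fun p : V × V => w p.1 p.2) (fun p => hw.star_eq p.1 p.2) a =
      FreeStar.eval (fun p : V × V => w p.1 p.2) (fun p => hw.star_eq p.1 p.2) b := by
  cases h with
  | qut _ _ h => exact hw.eval_eq h
  | comm c hcc i j k l hij hkl =>
    simp [genMatrix, FreeStar.eval_gen, hc c hcc i j k l hij hkl]

/-- The matrix of generators of a universal C*-algebra. -/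
def fundMatrix {rel : FreeStar (V × V) → FreeStar (V × V) → Prop} (hb : IsBoundedRel rel) :
    Matrix V V (UniversalCStar rel hb) :=
  Matrix.of fun i j => UniversalCStar.gen hb (i, j)

theorem mk_genMatrix {rel : FreeStar (V × V) → FreeStar (V × V) → Prop} (hb : IsBoundedRel rel)
    (i j : V) : UniversalCStar.mk hb (genMatrix V i j) = fundMatrix hb i j := rfl

theorem isQutMatrix_fundMatrix {rel : FreeStar (V × V) → FreeStar (V × V) → Prop}
    (hb : IsBoundedRel rel) (h : ∀ a b, QutRel G a b → rel a b) :
    IsQutMatrix G (fundMatrix hb) where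
  star_eq i j := UniversalCStar.star_gen hb (i, j)
  idem i j := by
    simpa [mk_genMatrix] using UniversalCStar.mk_eq_of_rel hb (h _ _ (QutRel.idem i j))
  row i := by
    simpa [mk_genMatrix] using UniversalCStar.mk_eq_of_rel hb (h _ _ (QutRel.row i))
  col i := by
    simpa [mk_genMatrix] using UniversalCStar.mk_eq_of_rel hb (h _ _ (QutRel.col i))
  vertexColor i j hij := by
    simpa [mk_genMatrix] using UniversalCStar.mk_eq_of_rel hb (h _ _ (QutRel.vertexColor i j hij))
  edgeColor c := by
    ext i j
    have := UniversalCStar.mk_eq_of_rel hb (h _ _ (QutRel.edgeColor c i j))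
    simp only [Matrix.mul_apply, ColoredGraph.adjMatrix, genMatrix, Matrix.of_apply, map_sum,
      map_mul, apply_ite (UniversalCStar.mk hb), map_one, map_zero] at this
    simp only [Matrix.mul_apply, ColoredGraph.adjMatrix, fundMatrix, Matrix.of_apply]
    exact this

end Lemmas

theorem isBoundedRel_qutRel : IsBoundedRel (QutRel G) :=
  isBoundedRel_of_idem G fun _ _ h => h

theorem isBoundedRel_qutStarRel (c₀ : CE) : IsBoundedRel (QutStarRel G c₀) :=
  isBoundedRel_of_idem G fun _ _ h => QutStarRel.qut _ _ h

theorem isQutMatrix_qut : IsQutMatrix G (fundMatrix (isBoundedRel_qutRel G)) :=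
  isQutMatrix_fundMatrix _ fun _ _ h => h

theorem isQutMatrix_qutStar (c₀ : CE) :
    IsQutMatrix G (fundMatrix (isBoundedRel_qutStarRel G c₀)) :=
  isQutMatrix_fundMatrix _ fun _ _ h => QutStarRel.qut _ _ h

theorem edgeCommute_qutStar (c₀ : CE) :
    EdgeCommute G c₀ (fundMatrix (isBoundedRel_qutStarRel G c₀)) := fun c hc i j k l hij hkl => by
  simpa [mk_genMatrix] using UniversalCStar.mk_eq_of_rel (isBoundedRel_qutStarRel G c₀)
    (QutStarRel.comm c hc i j k l hij hkl)

/-- The quantum automorphism group of a vertex- and edge-colored graph. -/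
def qut [DecidableEq V] : CompactMatrixQuantumGroup V where
  C := UniversalCStar (QutRel G) (isBoundedRel_qutRel G)
  u := fundMatrix (isBoundedRel_qutRel G)
  generates := UniversalCStar.topologicalClosure_adjoin_gen _
  comul := UniversalCStar.lift _
    (fun p => tensorMatrix (fundMatrix (isBoundedRel_qutRel G)) p.1 p.2)
    (fun p => (isQutMatrix_tensorMatrix (isQutMatrix_qut G)).star_eq p.1 p.2)
    fun _ _ h => (isQutMatrix_tensorMatrix (isQutMatrix_qut G)).eval_eq h
  comul_u i j := UniversalCStar.lift_gen _ _ _ _ (i, j)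
  isUnit_u := (isQutMatrix_qut G).isUnit
  isUnit_transpose := (isQutMatrix_qut G).isUnit_transpose

/-- The quantum subgroup of the quantum automorphism group on which the generators commute along
edges of the same color other than `c₀`. -/
def qutStar [DecidableEq V] (c₀ : CE) : CompactMatrixQuantumGroup V where
  C := UniversalCStar (QutStarRel G c₀) (isBoundedRel_qutStarRel G c₀)
  u := fundMatrix (isBoundedRel_qutStarRel G c₀)
  generates := UniversalCStar.topologicalClosure_adjoin_gen _
  comul := UniversalCStar.lift _
    (fun p => tensorMatrix (fundMatrix (isBoundedRel_qutStarRel G c₀)) p.1 p.2)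
    (fun p => (isQutMatrix_tensorMatrix (isQutMatrix_qutStar G c₀)).star_eq p.1 p.2)
    fun _ _ h => (isQutMatrix_tensorMatrix (isQutMatrix_qutStar G c₀)).eval_eq_of_star
      (edgeCommute_tensorMatrix (isQutMatrix_qutStar G c₀) (edgeCommute_qutStar G c₀)) h
  comul_u i j := UniversalCStar.lift_gen _ _ _ _ (i, j)
  isUnit_u := (isQutMatrix_qutStar G c₀).isUnit
  isUnit_transpose := (isQutMatrix_qutStar G c₀).isUnit_transpose

end Qut

end

/-! A *-homomorphism out of `C(Qut)` is the same as a magic unitary commuting with the adjacency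
matrices. So it suffices to pass, by mutually inverse constructions, between such matrices for the
subdivided graph and edge-commuting ones for the graph `H` being subdivided, here with its paths
already attached.

Commuting with an adjacency matrix means that `w i a * w j b` vanishes unless adjacency holds for
both or neither of `(i, j)` and `(a, b)`; this is `Preserves`. The relations so respected are closed
under Boolean operations and composition (`preserves_comp`), and the number of related elements is
respected too. Hence whatever degrees and adjacency can define is respected.

Restriction. Original vertices of degree at least three can be told apart from path vertices and
subdividing vertices, and path lengths recover the edge colors. So a magic unitary `w` of the
subdivided graph is block diagonal, and its block on the vertices of `H` is a magic unitary
respecting every edge color (`isQutMatrix_restrict`). For edges `e = {a, b}`, `f = {p, q}` let `W`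
be the entry of `w` at their subdividing vertices. Row and column sums give `W * w a p = W * w b q`.
Only the subdividing vertex of `f` is adjacent to both `p` and `q`, so `w a p * W * w b q = w a p *
w b q`. Therefore `w a p * w b q = w a p * W * w a p` is self-adjoint, that is, `w a p` and `w b q`
commute (`inl_commute`). The same reasoning yields `W = w a p * w b q + w a q * w b p`
(`mid_mid_eq`), and the entries along attached paths repeat `W` (`path_path`). So the block
determines `w`.

Extension. Conversely, that formula defines `extendMatrix`. Edge commutation makes it independent of
the ordering of the endpoints and makes its entries projections, and it commutes with the adjacency
matrix of the subdivided graph (`isQutMatrix_extendMatrix`).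

Both constructions are polynomial in the entries, which gives inverse *-homomorphisms. Block
diagonality removes the additional terms from the comultiplication. -/

noncomputable section

universe u

/-! ### Magic unitaries and the relations they preserve -/

section MagicUnitary

variable {V : Type*} [Fintype V] {B : Type*} [CStarAlgebra B]

/-- A matrix of projections whose rows and columns sum to one. -/
structure IsMagicUnitary (w : Matrix V V B) : Prop where
  star_eq : ∀ i j, star (w i j) = w i j
  idem : ∀ i j, w i j * w i j = w i j
  row : ∀ i, ∑ l, w i l = 1
  col : ∀ i, ∑ l, w l i = 1

/-- The matrix `w` respects the relation `R`: products `w i a * w j b` vanish unless `R` holds for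
both or for neither of `(i, j)` and `(a, b)`. -/
def Preserves (w : Matrix V V B) (R : V → V → Prop) : Prop :=
  ∀ i j a b, ¬(R i j ↔ R a b) → w i a * w j b = 0

/-- The matrix `w` respects the predicate `P`. -/
def PreservesPred (w : Matrix V V B) (P : V → Prop) : Prop :=
  ∀ i a, ¬(P i ↔ P a) → w i a = 0

variable {w : Matrix V V B} {R S : V → V → Prop} {P Q : V → Prop}

namespace IsMagicUnitary

theorem row_orthogonal (hw : IsMagicUnitary w) (i : V) {j k : V} (h : j ≠ k) :
    w i j * w i k = 0 :=
  proj_orthogonal (fun l => w i l) (hw.star_eq i) (hw.idem i) (hw.row i) h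

theorem col_orthogonal (hw : IsMagicUnitary w) (i : V) {j k : V} (h : j ≠ k) :
    w j i * w k i = 0 :=
  proj_orthogonal (fun l => w l i) (fun l => hw.star_eq l i) (fun l => hw.idem l i) (hw.col i) h

theorem transpose (hw : IsMagicUnitary w) : IsMagicUnitary w.transpose where
  star_eq i j := hw.star_eq j i
  idem i j := hw.idem j i
  row := hw.col
  col := hw.row

theorem mul_eq_zero_symm (hw : IsMagicUnitary w) {i a j b : V} (h : w i a * w j b = 0) :
    w j b * w i a = 0 := by
  simpa [hw.star_eq] using congrArg star h

theorem sum_mul_row (hw : IsMagicUnitary w) (i : V) (x : B) : ∑ l, x * w i l = x := by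
  rw [← Finset.mul_sum, hw.row, mul_one]

theorem sum_mul_col (hw : IsMagicUnitary w) (i : V) (x : B) : ∑ l, x * w l i = x := by
  rw [← Finset.mul_sum, hw.col, mul_one]

theorem preserves_eq (hw : IsMagicUnitary w) : Preserves w Eq := by
  intro i j a b h
  by_cases hij : i = j
  · subst hij
    exact hw.row_orthogonal i fun hab => h (by simp [hab])
  · by_cases hab : a = b
    · subst hab
      exact hw.col_orthogonal a hij
    · exact absurd (by simp [hij, hab]) h

/-- If `k` links `i` to `j`, insert `∑ c, w k c = 1` between `w i a` and `w j b`: a term survives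
only if `c` links `a` to `b`. The opposite direction is the same argument for the transpose, which
is why `key` is stated for an arbitrary `v`. -/
theorem preserves_comp (hw : IsMagicUnitary w) (hR : Preserves w R) (hS : Preserves w S) :
    Preserves w fun i j => ∃ k, R i k ∧ S k j := by
  have key : ∀ {v : Matrix V V B}, IsMagicUnitary v →
      (∀ i j a b, R i j → ¬ R a b → v i a * v j b = 0) →
      (∀ i j a b, S i j → ¬ S a b → v i a * v j b = 0) →
      ∀ i j a b, (∃ k, R i k ∧ S k j) → (¬ ∃ k, R a k ∧ S k b) → v i a * v j b = 0 := by
    intro v hv h1 h2 i j a b hk hn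
    obtain ⟨k, hik, hkj⟩ := hk
    rw [← hv.sum_mul_row k (v i a), Finset.sum_mul]
    refine Finset.sum_eq_zero fun c _ => ?_
    by_cases hac : R a c
    · rw [mul_assoc, h2 k j c b hkj fun hcb => hn ⟨c, hac, hcb⟩, mul_zero]
    · rw [h1 i k a c hik hac, zero_mul]
  intro i j a b h
  by_cases hij : ∃ k, R i k ∧ S k j
  · exact key hw (fun i j a b h h' => hR i j a b (by tauto)) (fun i j a b h h' => hS i j a b (by tauto))
      i j a b hij (fun h' => h (iff_of_true hij h'))
  · exact key hw.transpose (fun i j a b h h' => hR a b i j (by tauto))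
      (fun i j a b h h' => hS a b i j (by tauto)) a b i j (by_contra fun h' => h (iff_of_false hij h')) hij

theorem preserves_swap (hw : IsMagicUnitary w) (hR : Preserves w R) :
    Preserves w fun i j => R j i :=
  fun i j a b h => hw.mul_eq_zero_symm (hR j i b a h)

/-- Compose `R` with the relation that always holds and evaluate on the diagonal, where `w i a * w i
a = w i a`. -/
theorem preservesPred_exists (hw : IsMagicUnitary w) (hR : Preserves w R) :
    PreservesPred w fun i => ∃ k, R i k := by
  intro i a h
  have := hw.preserves_comp (S := fun _ _ => True) hR (fun _ _ _ _ h => absurd Iff.rfl h)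
  have h2 := this i i a a (by simpa using h)
  rwa [hw.idem] at h2

end IsMagicUnitary

theorem Preserves.not (hR : Preserves w R) : Preserves w fun i j => ¬ R i j :=
  fun i j a b h => hR i j a b (by tauto)

theorem Preserves.and (hR : Preserves w R) (hS : Preserves w S) :
    Preserves w fun i j => R i j ∧ S i j := fun i j a b h => by
  by_cases h1 : R i j ↔ R a b
  · exact hS i j a b (by tauto)
  · exact hR i j a b h1

theorem PreservesPred.not (hP : PreservesPred w P) : PreservesPred w fun i => ¬ P i :=
  fun i a h => hP i a (by tauto)

theorem PreservesPred.and (hP : PreservesPred w P) (hQ : PreservesPred w Q) :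
    PreservesPred w fun i => P i ∧ Q i := fun i a h => by
  by_cases h1 : P i ↔ P a
  · exact hQ i a (by tauto)
  · exact hP i a h1

theorem PreservesPred.or (hP : PreservesPred w P) (hQ : PreservesPred w Q) :
    PreservesPred w fun i => P i ∨ Q i := fun i a h => by
  by_cases h1 : P i ↔ P a
  · exact hQ i a (by tauto)
  · exact hP i a h1

theorem PreservesPred.left (hP : PreservesPred w P) : Preserves w fun i _ => P i :=
  fun i j a b h => by rw [hP i a h, zero_mul]

theorem PreservesPred.right (hP : PreservesPred w P) : Preserves w fun _ j => P j :=
  fun i j a b h => by rw [hP j b h, mul_zero]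

theorem Preserves.congr (hR : Preserves w R) (h : ∀ i j, R i j ↔ S i j) : Preserves w S := by
  have : R = S := funext fun i => funext fun j => propext (h i j)
  exact this ▸ hR

theorem PreservesPred.congr (hP : PreservesPred w P) (h : ∀ i, P i ↔ Q i) : PreservesPred w Q := by
  have : P = Q := funext fun i => propext (h i)
  exact this ▸ hP

theorem IsMagicUnitary.preservesPred_exists_adj (hw : IsMagicUnitary w) (hR : Preserves w R)
    (hP : PreservesPred w P) : PreservesPred w fun i => ∃ k, R i k ∧ P k :=
  hw.preservesPred_exists (hR.and hP.right)

/-- The number of elements related to a given one is respected. -/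
theorem IsMagicUnitary.mul_eq_zero_of_ncard_ne (hw : IsMagicUnitary w) (hR : Preserves w R)
    {i a : V} (h : {k | R i k}.ncard ≠ {k | R a k}.ncard) : w i a = 0 := by
  classical
  have h1 : ∀ i, {k | R i k}.ncard = ∑ k, if R i k then 1 else 0 := fun i => by
    rw [Set.ncard_eq_toFinset_card', Finset.card_eq_sum_ones, Finset.sum_ite, Finset.sum_const_zero,
      add_zero]
    congr 1
    ext; simp
  -- Double counting: the two sums agree term by term because `R` is respected. Summing out `b` on
  -- one side and `k` on the other leaves `w i a` multiplied by the two cardinalities.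
  have h2 : ∑ k, ∑ b, (if R i k then w i a * w k b else 0) =
      ∑ k, ∑ b, (if R a b then w i a * w k b else 0) := by
    refine Finset.sum_congr rfl fun k _ => Finset.sum_congr rfl fun b _ => ?_
    by_cases h3 : R i k ↔ R a b
    · simp only [h3]
    · simp [hR i k a b h3]
  conv_rhs at h2 => rw [Finset.sum_comm]
  have h3 : ∀ (p : Prop) [Decidable p] (f : V → B), (∑ b, if p then f b else 0) =
      if p then ∑ b, f b else 0 := fun p _ f => by split_ifs <;> simp
  simp only [h3, hw.sum_mul_row, hw.sum_mul_col] at h2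
  have h4 : ∀ j, (∑ k, if R j k then w i a else 0) = (({k | R j k}.ncard : ℕ) : ℂ) • w i a := by
    intro j
    rw [h1 j]
    push_cast
    rw [Finset.sum_smul]
    refine Finset.sum_congr rfl fun k _ => ?_
    split_ifs <;> simp
  rw [h4, h4, ← sub_eq_zero, ← sub_smul, smul_eq_zero, sub_eq_zero, Nat.cast_inj] at h2
  exact h2.resolve_left h

theorem IsMagicUnitary.preservesPred_ncard (hw : IsMagicUnitary w) (hR : Preserves w R)
    (p : ℕ → Prop) : PreservesPred w fun i => p {k | R i k}.ncard := fun i a h =>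
  hw.mul_eq_zero_of_ncard_ne hR fun h' => h (by simp only [h'])

end MagicUnitary

/-! ### Commuting with adjacency matrices as invariance of edge relations -/

section QutMatrix

variable {V : Type u} [Fintype V] {CV CE : Type*} {G : ColoredGraph V CV CE}
  {B : Type*} [CStarAlgebra B] {w : Matrix V V B}

theorem IsQutMatrix.isMagicUnitary (hw : IsQutMatrix G w) : IsMagicUnitary w :=
  ⟨hw.star_eq, hw.idem, hw.row, hw.col⟩

theorem IsQutMatrix.transpose (hw : IsQutMatrix G w) : IsQutMatrix G w.transpose where
  star_eq i j := hw.star_eq j i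
  idem i j := hw.idem j i
  row := hw.col
  col := hw.row
  vertexColor i j h := hw.vertexColor j i h.symm
  edgeColor c := by
    classical
    -- Conjugating `A * w = w * A` by the inverse `w.transpose` gives the relation for the
    -- transpose. Through this duality, one-sided vanishing statements become two-sided.
    have h := congrArg (fun M => w.transpose * M * w.transpose) (hw.edgeColor c)
    rw [← mul_assoc, mul_assoc, hw.mul_transpose, mul_one, ← mul_assoc, hw.transpose_mul,
      one_mul] at h
    exact h.symm

theorem IsQutMatrix.preserves_isEdge (hw : IsQutMatrix G w) (c : CE) :
    Preserves w (G.IsEdge c) := by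
  intro i j a b h
  by_cases hij : G.IsEdge c i j
  · exact hw.mul_eq_zero_of_isEdge hij (by tauto)
  · exact hw.transpose.mul_eq_zero_of_isEdge (i := a) (j := b) (a := i) (b := j) (by tauto) hij

/-- Insert the row sum of `i` into `(A * w) i b`, exchange the condition on `(i, k)` for the one on
`(a, b)`, and sum out `k` by the column sum of `b`. -/
theorem IsMagicUnitary.isQutMatrix (hw : IsMagicUnitary w)
    (hv : ∀ i j, G.vcolor i ≠ G.vcolor j → w i j = 0)
    (he : ∀ c, Preserves w (G.IsEdge c)) : IsQutMatrix G w where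
  star_eq := hw.star_eq
  idem := hw.idem
  row := hw.row
  col := hw.col
  vertexColor := hv
  edgeColor c := by
    classical
    ext i b
    simp only [Matrix.mul_apply, ColoredGraph.adjMatrix, Matrix.of_apply, ite_mul, one_mul,
      zero_mul, mul_ite, mul_one, mul_zero]
    have h3 : ∀ (p : Prop) [Decidable p] (f : V → B), (if p then ∑ b, f b else 0) =
      (∑ b, if p then f b else 0) := fun p _ f => by split_ifs <;> simp
    calc (∑ k, if G.IsEdge c i k then w k b else 0)
        = ∑ k, ∑ a, if G.IsEdge c i k then w i a * w k b else 0 := by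
          refine Finset.sum_congr rfl fun k _ => ?_
          rw [← h3, ← Finset.sum_mul, hw.row, one_mul]
      _ = ∑ k, ∑ a, if G.IsEdge c a b then w i a * w k b else 0 := by
          refine Finset.sum_congr rfl fun k _ => Finset.sum_congr rfl fun a _ => ?_
          by_cases h : G.IsEdge c i k ↔ G.IsEdge c a b
          · simp only [h]
          · simp [he c i k a b h]
      _ = _ := by
          rw [Finset.sum_comm]
          refine Finset.sum_congr rfl fun a _ => ?_
          rw [← h3, hw.sum_mul_col]

theorem IsQutMatrix.preserves_adj {X : SimpleGraph V} (hw : IsQutMatrix (.ofGraph X) w) :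
    Preserves w X.Adj :=
  (hw.preserves_isEdge ()).congr fun _ _ => and_iff_left rfl

end QutMatrix

/-! ### Combinatorics of the subdivided graph -/

namespace ColoredGraph

variable {V : Type u} {CV CE : Type*} (H : ColoredGraph V CV CE) (c₀ : CE)

/-- The vertices outside `core` lie on attached paths of color `c₀`, and the vertices in `core`
have degree at least three even without these paths. -/
structure HasTails (core : V → Prop) : Prop where
  core_deg : ∀ x, core x → 3 ≤ {y | H.graph.Adj x y}.ncard
  core_deg' : ∀ x y, core x → H.graph.Adj x y → ¬ core y → 4 ≤ {y | H.graph.Adj x y}.ncard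
  tail_color : ∀ x y, ¬ core x → H.graph.Adj x y → H.ecolor s(x, y) = c₀
  tail_deg : ∀ x, ¬ core x → {y | H.graph.Adj x y}.ncard ≤ 2
  tail_leaf : ∀ x, ¬ core x → {y | H.graph.Adj x y}.ncard = 1 ∨ ∃ y, H.graph.Adj x y ∧ ¬ core y

variable (m : CE → ℕ)

/-- The degree of a vertex of the subdivided graph. -/
def subDeg (q : V ⊕ Σ e : H.SubdividedEdge c₀, Fin (m (H.ecolor e.1) + 1)) : ℕ :=
  {r | (H.subdivide c₀ m).Adj q r}.ncard

/-- Vertices of degree two all of whose neighbors have degree at least three. -/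
def IsBareMid (q : V ⊕ Σ e : H.SubdividedEdge c₀, Fin (m (H.ecolor e.1) + 1)) : Prop :=
  H.subDeg c₀ m q = 2 ∧ ¬ ∃ r, (H.subdivide c₀ m).Adj q r ∧ H.subDeg c₀ m r ≤ 2

/-- Vertices on the attached paths. -/
def IsTail (q : V ⊕ Σ e : H.SubdividedEdge c₀, Fin (m (H.ecolor e.1) + 1)) : Prop :=
  H.subDeg c₀ m q ≤ 2 ∧ ¬ H.IsBareMid c₀ m q

/-- Vertices that subdivide an edge. -/
def IsMid (q : V ⊕ Σ e : H.SubdividedEdge c₀, Fin (m (H.ecolor e.1) + 1)) : Prop :=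
  H.IsBareMid c₀ m q ∨ (H.subDeg c₀ m q = 3 ∧ ∃ r, (H.subdivide c₀ m).Adj q r ∧ H.IsTail c₀ m r)

/-- The first vertex subdivides an edge, and the second is at distance `k` from it on the path
attached to it. -/
def MidTail (k : ℕ) (s q : V ⊕ Σ e : H.SubdividedEdge c₀, Fin (m (H.ecolor e.1) + 1)) : Prop :=
  ∃ (e : H.SubdividedEdge c₀) (hk : k < m (H.ecolor e.1) + 1),
    s = .inr ⟨e, 0⟩ ∧ q = .inr ⟨e, ⟨k, hk⟩⟩

variable {H c₀ m} {core : V → Prop}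

theorem SubdividedEdge.exists_eq (e : H.SubdividedEdge c₀) :
    ∃ a b, e.1 = s(a, b) ∧ H.graph.Adj a b ∧ H.ecolor s(a, b) ≠ c₀ := by
  obtain ⟨e, h1, h2⟩ := e
  induction e using Sym2.ind with
  | _ a b => exact ⟨a, b, rfl, h1, h2⟩

theorem SubdividedEdge.exists_eq_of_mem {e : H.SubdividedEdge c₀} {a : V} (ha : a ∈ e.1) :
    ∃ b, e.1 = s(a, b) ∧ H.graph.Adj a b ∧ H.ecolor s(a, b) ≠ c₀ := by
  obtain ⟨b, hb⟩ := Sym2.mem_iff_exists.mp ha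
  obtain ⟨e, h1, h2⟩ := e
  simp only at hb
  subst hb
  exact ⟨b, rfl, h1, h2⟩

/-- Edges meeting a vertex outside `core` have color `c₀` and so are never subdivided. -/
theorem HasTails.core_of_mem (h : H.HasTails c₀ core) {e : H.SubdividedEdge c₀} {x : V}
    (hx : x ∈ e.1) : core x := by
  obtain ⟨b, -, hab, hc⟩ := SubdividedEdge.exists_eq_of_mem hx
  by_contra hn
  exact hc (h.tail_color x b hn hab)

/-! ### Recognizing the kinds of vertices of the subdivided graph by degrees -/

section Finite

variable [Finite V]

/-- Subdivision does not lower the degree of an old vertex: each neighbor survives or is replaced by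
the vertex subdividing its edge, and these replacements are distinct. Equality holds as well, but
only the bound is needed. -/
theorem ncard_le_subDeg_inl (x : V) :
    {y | H.graph.Adj x y}.ncard ≤ H.subDeg c₀ m (.inl x) := by
  classical
  refine Set.ncard_le_ncard_of_injOn (fun y =>
    if h : H.graph.Adj x y ∧ H.ecolor s(x, y) ≠ c₀ then .inr ⟨⟨s(x, y), h⟩, 0⟩ else .inl y)
    ?_ ?_ (Set.toFinite _)
  · intro y hy
    simp only [Set.mem_ofPred_eq] at hy ⊢
    split_ifs with h
    · exact ⟨Sym2.mem_mk_left x y, rfl⟩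
    · exact ⟨hy, by tauto⟩
  · intro y hy z hz hyz
    simp only at hyz
    split_ifs at hyz with h1 h2 h2
    · have := congrArg (fun p : Σ e : H.SubdividedEdge c₀, Fin (m (H.ecolor e.1) + 1) => p.1.1)
        (Sum.inr_injective hyz)
      rcases Sym2.eq_iff.mp this with h | h
      · exact h.2
      · exact h.2.trans h.1
    · exact Sum.inl_injective hyz

theorem HasTails.subDeg_tail (h : H.HasTails c₀ core) {x : V} (hx : ¬ core x) :
    H.subDeg c₀ m (.inl x) = {y | H.graph.Adj x y}.ncard := by
  rw [← Set.ncard_image_of_injective _ (Sum.inl_injective (α := V)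
    (β := Σ e : H.SubdividedEdge c₀, Fin (m (H.ecolor e.1) + 1)))]
  unfold subDeg
  congr 1
  ext (y | p)
  · simp only [Set.mem_ofPred_eq, Set.mem_image, Sum.inl.injEq, exists_eq_right]
    exact ⟨fun h' => h'.1, fun h' => ⟨h', h.tail_color x y hx h'⟩⟩
  · simp only [Set.mem_ofPred_eq, Set.mem_image, reduceCtorEq, and_false, exists_false, iff_false]
    exact fun h' => hx (h.core_of_mem h'.1)

theorem subDeg_mid {e : H.SubdividedEdge c₀} (he : m (H.ecolor e.1) = 0) :
    H.subDeg c₀ m (.inr ⟨e, 0⟩) = 2 := by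
  obtain ⟨a, b, hab, hadj, -⟩ := e.exists_eq
  rw [← Set.ncard_pair (fun h => hadj.ne (Sum.inl_injective h) : (Sum.inl a :
    V ⊕ Σ e : H.SubdividedEdge c₀, Fin (m (H.ecolor e.1) + 1)) ≠ .inl b)]
  unfold subDeg
  congr 1
  ext (y | p)
  · change (y ∈ e.1 ∧ _) ↔ _
    simp [hab]
  · change (e = p.1 ∧ _) ↔ _
    simp only [Set.mem_insert_iff, reduceCtorEq, Set.mem_singleton_iff, or_self, iff_false]
    rintro ⟨h1, h2⟩
    obtain ⟨f, i⟩ := p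
    simp only at h1
    subst h1
    have := i.2
    simp at h2
    omega

theorem subDeg_mid' {e : H.SubdividedEdge c₀} (he : 0 < m (H.ecolor e.1)) :
    H.subDeg c₀ m (.inr ⟨e, 0⟩) = 3 := by
  obtain ⟨a, b, hab, hadj, -⟩ := e.exists_eq
  have h3 : ({.inr ⟨e, ⟨1, by omega⟩⟩, .inl a, .inl b} :
      Set (V ⊕ Σ e : H.SubdividedEdge c₀, Fin (m (H.ecolor e.1) + 1))).ncard = 3 := by
    rw [Set.ncard_insert_of_notMem (by simp) (Set.toFinite _),
      Set.ncard_pair (fun h => hadj.ne (Sum.inl_injective h))]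
  rw [← h3]
  unfold subDeg
  congr 1
  ext (y | p)
  · change (y ∈ e.1 ∧ _) ↔ _
    simp [hab]
  · change (e = p.1 ∧ _) ↔ _
    obtain ⟨f, i⟩ := p
    simp only [Set.mem_insert_iff, reduceCtorEq, Set.mem_singleton_iff, or_false, Sum.inr.injEq]
    constructor
    · rintro ⟨h1, h2⟩
      subst h1
      simp at h2
      congr 1
      ext
      exact h2.symm
    · rintro h
      obtain ⟨rfl, h⟩ := Sigma.mk.inj h
      rw [eq_of_heq h]
      simp

theorem subDeg_path_le {e : H.SubdividedEdge c₀} {i : Fin (m (H.ecolor e.1) + 1)}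
    (hi : (i : ℕ) ≠ 0) : H.subDeg c₀ m (.inr ⟨e, i⟩) ≤ 2 := by
  -- The neighbors have index `i - 1` or `i + 1`. At the end of the path `Fin.ofNat` wraps `i + 1`
  -- to `0`, which is harmless since only an inclusion is needed.
  refine (Set.ncard_le_ncard (t := (fun k : ℕ => (.inr ⟨e, Fin.ofNat _ k⟩ :
    V ⊕ Σ e : H.SubdividedEdge c₀, Fin (m (H.ecolor e.1) + 1))) '' {(i : ℕ) - 1, (i : ℕ) + 1}) ?_
    (Set.toFinite _)).trans ((Set.ncard_image_le (Set.toFinite _)).trans ((Set.ncard_insert_le _ _).trans_eq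
      (by rw [Set.ncard_singleton])))
  · rintro (y | ⟨f, j⟩) h
    · exact absurd h.2 hi
    · obtain ⟨h1, h2⟩ := h
      simp only at h1 h2
      subst h1
      refine ⟨j, by simp; omega, ?_⟩
      beta_reduce
      congr 2
      ext
      simp

theorem subDeg_path_last {e : H.SubdividedEdge c₀} {i : Fin (m (H.ecolor e.1) + 1)}
    (hi : (i : ℕ) ≠ 0) (hl : (i : ℕ) = m (H.ecolor e.1)) : H.subDeg c₀ m (.inr ⟨e, i⟩) ≤ 1 := by
  refine (Set.ncard_le_ncard (t := {(.inr ⟨e, Fin.ofNat _ (i - 1)⟩ :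
    V ⊕ Σ e : H.SubdividedEdge c₀, Fin (m (H.ecolor e.1) + 1))}) ?_
    (Set.toFinite _)).trans_eq (Set.ncard_singleton _)
  rintro (y | ⟨f, j⟩) h
  · exact absurd h.2 hi
  · obtain ⟨h1, h2⟩ := h
    simp only at h1 h2
    subst h1
    have hj := j.2
    rw [Set.mem_singleton_iff]
    congr 2
    ext
    rw [Fin.val_ofNat, Nat.mod_eq_of_lt (by omega)]
    omega

/-- Vertices in `core` and subdividing vertices with a path have degree at least three. Every path
vertex either is a leaf or has a next path vertex, of degree at most two. Only subdividing vertices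
without a path remain, and their neighbors lie in `core`. -/
theorem HasTails.isBareMid_iff (h : H.HasTails c₀ core)
    (q : V ⊕ Σ e : H.SubdividedEdge c₀, Fin (m (H.ecolor e.1) + 1)) :
    H.IsBareMid c₀ m q ↔ ∃ e, m (H.ecolor e.1) = 0 ∧ q = .inr ⟨e, 0⟩ := by
  constructor
  · rintro ⟨h2, hn⟩
    rcases q with x | ⟨e, i⟩
    · by_cases hx : core x
      · have := (h.core_deg x hx).trans (ncard_le_subDeg_inl (c₀ := c₀) (m := m) x)
        omega
      · rcases h.tail_leaf x hx with h1 | ⟨y, hy, hyc⟩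
        · rw [h.subDeg_tail hx] at h2
          omega
        · refine absurd ⟨.inl y, ⟨hy, h.tail_color x y hx hy⟩, ?_⟩ hn
          rw [h.subDeg_tail hyc]
          exact h.tail_deg y hyc
    · by_cases hi : (i : ℕ) = 0
      · have hi' : i = 0 := Fin.ext hi
        subst hi'
        refine ⟨e, ?_, rfl⟩
        by_contra hm
        rw [subDeg_mid' (by omega)] at h2
        omega
      · by_cases hl : (i : ℕ) = m (H.ecolor e.1)
        · have := subDeg_path_last hi hl
          omega
        · have := i.2
          exact absurd ⟨.inr ⟨e, ⟨i + 1, by omega⟩⟩, ⟨rfl, Or.inl rfl⟩, subDeg_path_le (by simp)⟩ hn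
  · rintro ⟨e, he, rfl⟩
    refine ⟨subDeg_mid he, ?_⟩
    rintro ⟨y | ⟨f, j⟩, hr, hd⟩
    · have := (h.core_deg y (h.core_of_mem hr.1)).trans
        (ncard_le_subDeg_inl (c₀ := c₀) (m := m) y)
      omega
    · obtain ⟨h1, h2⟩ := hr
      simp only at h1 h2
      subst h1
      have := j.2
      simp at h2
      omega

theorem HasTails.isTail_inl (h : H.HasTails c₀ core) (x : V) :
    H.IsTail c₀ m (.inl x) ↔ ¬ core x := by
  rw [IsTail, h.isBareMid_iff]
  simp only [reduceCtorEq, and_false, exists_false, not_false_eq_true, and_true]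
  constructor
  · intro h1 hx
    have := (h.core_deg x hx).trans (ncard_le_subDeg_inl (c₀ := c₀) (m := m) x)
    omega
  · intro hx
    rw [h.subDeg_tail hx]
    exact h.tail_deg x hx

theorem HasTails.isTail_inr (h : H.HasTails c₀ core) (e : H.SubdividedEdge c₀)
    (i : Fin (m (H.ecolor e.1) + 1)) : H.IsTail c₀ m (.inr ⟨e, i⟩) ↔ (i : ℕ) ≠ 0 := by
  rw [IsTail, h.isBareMid_iff]
  constructor
  · rintro ⟨h1, h2⟩ hi
    have hi' : i = 0 := Fin.ext hi
    subst hi'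
    by_cases hm : m (H.ecolor e.1) = 0
    · exact h2 ⟨e, hm, rfl⟩
    · rw [subDeg_mid' (by omega)] at h1
      omega
  · intro hi
    refine ⟨subDeg_path_le hi, ?_⟩
    rintro ⟨f, hf, he⟩
    have := Sum.inr_injective he
    obtain ⟨rfl, h3⟩ := Sigma.mk.inj this
    rw [eq_of_heq h3] at hi
    exact hi rfl

/-- The danger is a `core` vertex of degree three next to a path vertex. It does not occur: by
`core_deg'`, a `core` vertex carrying a path has degree at least four. -/
theorem HasTails.isMid_iff (h : H.HasTails c₀ core)
    (q : V ⊕ Σ e : H.SubdividedEdge c₀, Fin (m (H.ecolor e.1) + 1)) :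
    H.IsMid c₀ m q ↔ ∃ e, q = .inr ⟨e, 0⟩ := by
  constructor
  · rintro (h1 | ⟨h3, r, hr, ht⟩)
    · obtain ⟨e, -, he⟩ := (h.isBareMid_iff q).mp h1
      exact ⟨e, he⟩
    · rcases q with x | ⟨e, i⟩
      · exfalso
        have hx : core x := by
          by_contra hx
          have := h.tail_deg x hx
          rw [h.subDeg_tail hx] at h3
          omega
        rcases r with y | ⟨f, j⟩
        · rw [h.isTail_inl] at ht
          have := (h.core_deg' x y hx hr.1 ht).trans (ncard_le_subDeg_inl (c₀ := c₀) (m := m) x)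
          omega
        · rw [h.isTail_inr] at ht
          exact ht hr.2
      · by_cases hi : (i : ℕ) = 0
        · exact ⟨e, by rw [show i = 0 from Fin.ext hi]⟩
        · have := subDeg_path_le hi
          omega
  · rintro ⟨e, rfl⟩
    by_cases hm : m (H.ecolor e.1) = 0
    · exact Or.inl ((h.isBareMid_iff _).mpr ⟨e, hm, rfl⟩)
    · exact Or.inr ⟨subDeg_mid' (by omega), .inr ⟨e, ⟨1, by omega⟩⟩, ⟨rfl, Or.inl rfl⟩,
        (h.isTail_inr _ _).mpr one_ne_zero⟩

theorem HasTails.midTail_zero (h : H.HasTails c₀ core)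
    (s q : V ⊕ Σ e : H.SubdividedEdge c₀, Fin (m (H.ecolor e.1) + 1)) :
    H.IsMid c₀ m s ∧ s = q ↔ H.MidTail c₀ m 0 s q := by
  rw [h.isMid_iff]
  constructor
  · rintro ⟨⟨e, rfl⟩, rfl⟩
    exact ⟨e, by omega, rfl, rfl⟩
  · rintro ⟨e, _, rfl, rfl⟩
    exact ⟨⟨e, rfl⟩, rfl⟩

/-- One step further along a path: move to an adjacent path vertex without turning back. For `k = 0`
truncated subtraction makes the excluded vertex the starting point, which is not a path vertex
anyway. -/
theorem HasTails.midTail_succ (h : H.HasTails c₀ core) (k : ℕ)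
    (s q : V ⊕ Σ e : H.SubdividedEdge c₀, Fin (m (H.ecolor e.1) + 1)) :
    ((∃ r, H.MidTail c₀ m k s r ∧ (H.subdivide c₀ m).Adj r q) ∧ H.IsTail c₀ m q) ∧
      ¬ H.MidTail c₀ m (k - 1) s q ↔ H.MidTail c₀ m (k + 1) s q := by
  constructor
  · rintro ⟨⟨⟨_, ⟨e, hk, rfl, rfl⟩, hadj⟩, ht⟩, hn⟩
    rcases q with y | ⟨f, j⟩
    · exact absurd (h.core_of_mem hadj.1) ((h.isTail_inl y).mp ht)
    · obtain ⟨h1, h2⟩ := hadj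
      simp only at h1 h2
      subst h1
      rw [h.isTail_inr] at ht
      have hj := j.2
      rcases h2 with h2 | h2
      · refine ⟨e, by omega, rfl, ?_⟩
        congr 2
        ext
        exact h2.symm
      · refine absurd ⟨e, by omega, rfl, ?_⟩ hn
        congr 2
        ext
        simp only
        omega
  · rintro ⟨e, hk, rfl, rfl⟩
    refine ⟨⟨⟨_, ⟨e, by omega, rfl, rfl⟩, ⟨rfl, Or.inl rfl⟩⟩, (h.isTail_inr _ _).mpr (by simp)⟩, ?_⟩
    rintro ⟨f, hf, h1, h2⟩
    obtain ⟨rfl, h3⟩ := Sigma.mk.inj (Sum.inr_injective h2)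
    have := congrArg Fin.val (eq_of_heq h3)
    simp only at this
    omega

end Finite

end ColoredGraph

/-! ### Restriction of magic unitaries of the subdivided graph -/

section Restrict

open ColoredGraph

variable {V : Type u} [Fintype V] {CV CE : Type*} {H : ColoredGraph V CV CE} {c₀ : CE}
  {m : CE → ℕ} {core : V → Prop} {B : Type*} [CStarAlgebra B]
  {w : Matrix (V ⊕ Σ e : H.SubdividedEdge c₀, Fin (m (H.ecolor e.1) + 1))
    (V ⊕ Σ e : H.SubdividedEdge c₀, Fin (m (H.ecolor e.1) + 1)) B}

namespace IsQutMatrix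

/-- The predicate is assembled from degrees and neighbors by operations that keep invariance; this
is why the kinds of vertices were defined by degrees rather than by constructors. -/
theorem preservesPred_isBareMid (hw : IsQutMatrix (.ofGraph (H.subdivide c₀ m)) w) :
    PreservesPred w (H.IsBareMid c₀ m) :=
  (hw.isMagicUnitary.preservesPred_ncard hw.preserves_adj (· = 2)).and
    (hw.isMagicUnitary.preservesPred_exists_adj hw.preserves_adj
      (hw.isMagicUnitary.preservesPred_ncard hw.preserves_adj (· ≤ 2))).not

theorem preservesPred_isTail (hw : IsQutMatrix (.ofGraph (H.subdivide c₀ m)) w) :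
    PreservesPred w (H.IsTail c₀ m) :=
  (hw.isMagicUnitary.preservesPred_ncard hw.preserves_adj (· ≤ 2)).and
    hw.preservesPred_isBareMid.not

theorem preservesPred_isMid (hw : IsQutMatrix (.ofGraph (H.subdivide c₀ m)) w) :
    PreservesPred w (H.IsMid c₀ m) :=
  hw.preservesPred_isBareMid.or
    ((hw.isMagicUnitary.preservesPred_ncard hw.preserves_adj (· = 3)).and
      (hw.isMagicUnitary.preservesPred_exists_adj hw.preserves_adj hw.preservesPred_isTail))

theorem preserves_midTail (hw : IsQutMatrix (.ofGraph (H.subdivide c₀ m)) w)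
    (h : H.HasTails c₀ core) (k : ℕ) : Preserves w (H.MidTail c₀ m k) := by
  induction k using Nat.strong_induction_on with
  | _ k ih =>
    rcases k with _ | k
    · exact (hw.preservesPred_isMid.left.and hw.isMagicUnitary.preserves_eq).congr h.midTail_zero
    · exact (((hw.isMagicUnitary.preserves_comp (ih k (by omega)) hw.preserves_adj).and
        hw.preservesPred_isTail.right).and (ih (k - 1) (by omega)).not).congr (h.midTail_succ k)

theorem inr_eq_zero (hw : IsQutMatrix (.ofGraph (H.subdivide c₀ m)) w)
    (h : H.HasTails c₀ core) {e : H.SubdividedEdge c₀} {i : Fin (m (H.ecolor e.1) + 1)}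
    {q : V ⊕ Σ e : H.SubdividedEdge c₀, Fin (m (H.ecolor e.1) + 1)}
    (hq : ¬ ∃ s, H.MidTail c₀ m i s q) : w (.inr ⟨e, i⟩) q = 0 :=
  hw.isMagicUnitary.preservesPred_exists
    (hw.isMagicUnitary.preserves_swap (hw.preserves_midTail h i)) _ _
    fun h' => hq (h'.mp ⟨_, e, i.2, rfl, rfl⟩)

theorem inr_inl (hw : IsQutMatrix (.ofGraph (H.subdivide c₀ m)) w)
    (h : H.HasTails c₀ core) (p : Σ e : H.SubdividedEdge c₀, Fin (m (H.ecolor e.1) + 1)) (x : V) :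
    w (.inr p) (.inl x) = 0 := by
  refine hw.inr_eq_zero h ?_
  rintro ⟨s, e, hk, -, h2⟩
  cases h2

theorem inl_inr (hw : IsQutMatrix (.ofGraph (H.subdivide c₀ m)) w)
    (h : H.HasTails c₀ core) (x : V) (p : Σ e : H.SubdividedEdge c₀, Fin (m (H.ecolor e.1) + 1)) :
    w (.inl x) (.inr p) = 0 :=
  hw.transpose.inr_inl h p x

theorem inr_inr_of_ne (hw : IsQutMatrix (.ofGraph (H.subdivide c₀ m)) w)
    (h : H.HasTails c₀ core) {e f : H.SubdividedEdge c₀} {i : Fin (m (H.ecolor e.1) + 1)}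
    {j : Fin (m (H.ecolor f.1) + 1)} (hij : (i : ℕ) ≠ j) : w (.inr ⟨e, i⟩) (.inr ⟨f, j⟩) = 0 := by
  refine hw.inr_eq_zero h ?_
  rintro ⟨s, g, hk, -, h2⟩
  obtain ⟨rfl, h3⟩ := Sigma.mk.inj (Sum.inr_injective h2)
  exact hij (congrArg Fin.val (eq_of_heq h3)).symm

/-- Being the start of a path that reaches distance `m (H.ecolor e.1)` is an invariant property; `e`
has it and `f` does not. -/
theorem mid_mid_of_lt (hw : IsQutMatrix (.ofGraph (H.subdivide c₀ m)) w)
    (h : H.HasTails c₀ core) {e f : H.SubdividedEdge c₀}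
    (hef : m (H.ecolor f.1) < m (H.ecolor e.1)) : w (.inr ⟨e, 0⟩) (.inr ⟨f, 0⟩) = 0 := by
  refine hw.isMagicUnitary.preservesPred_exists (hw.preserves_midTail h (m (H.ecolor e.1))) _ _
    fun h' => ?_
  obtain ⟨s, g, hg, h1, -⟩ := h'.mp ⟨_, e, by omega, rfl, rfl⟩
  obtain ⟨rfl, -⟩ := Sigma.mk.inj (Sum.inr_injective h1)
  omega

theorem mid_mid_of_ne (hw : IsQutMatrix (.ofGraph (H.subdivide c₀ m)) w)
    (h : H.HasTails c₀ core)
    (hm : Set.InjOn m {c | c ≠ c₀ ∧ ∃ e ∈ H.graph.edgeSet, H.ecolor e = c})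
    {e f : H.SubdividedEdge c₀} (hef : H.ecolor e.1 ≠ H.ecolor f.1) :
    w (.inr ⟨e, 0⟩) (.inr ⟨f, 0⟩) = 0 := by
  rcases lt_trichotomy (m (H.ecolor e.1)) (m (H.ecolor f.1)) with h1 | h1 | h1
  · exact hw.transpose.mid_mid_of_lt h h1
  · exact absurd (hm ⟨e.2.2, e.1, e.2.1, rfl⟩ ⟨f.2.2, f.1, f.2.1, rfl⟩ h1) hef
  · exact hw.mid_mid_of_lt h h1

/-- A path vertex determines the subdividing vertex it hangs from, so in the row sum of `(e, 0)`
only the term at `(f, 0)` survives. -/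
theorem mid_mul_path (hw : IsQutMatrix (.ofGraph (H.subdivide c₀ m)) w)
    (h : H.HasTails c₀ core) (e f : H.SubdividedEdge c₀) (i : Fin (m (H.ecolor e.1) + 1))
    (j : Fin (m (H.ecolor f.1) + 1)) :
    w (.inr ⟨e, 0⟩) (.inr ⟨f, 0⟩) * w (.inr ⟨e, i⟩) (.inr ⟨f, j⟩) =
      w (.inr ⟨e, i⟩) (.inr ⟨f, j⟩) := by
  conv_rhs => rw [← one_mul (w (.inr ⟨e, i⟩) (.inr ⟨f, j⟩)), ← hw.row (.inr ⟨e, 0⟩),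
    Finset.sum_mul]
  symm
  refine Fintype.sum_eq_single (α := V ⊕ Σ e : H.SubdividedEdge c₀, Fin (m (H.ecolor e.1) + 1))
    (.inr ⟨f, 0⟩) fun s hs => ?_
  refine hw.preserves_midTail h i _ _ _ _ fun h' => ?_
  obtain ⟨g, hg, h1, h2⟩ := h'.mp ⟨e, i.2, rfl, rfl⟩
  obtain ⟨rfl, -⟩ := Sigma.mk.inj (Sum.inr_injective h2)
  exact hs h1

/-- The subdividing vertex and the distance determine the path vertex in turn. Hence the product in
`mid_mul_path` also equals its first factor. -/
theorem path_path (hw : IsQutMatrix (.ofGraph (H.subdivide c₀ m)) w)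
    (h : H.HasTails c₀ core) {e f : H.SubdividedEdge c₀}
    {i : Fin (m (H.ecolor e.1) + 1)} {j : Fin (m (H.ecolor f.1) + 1)} (hij : (i : ℕ) = j) :
    w (.inr ⟨e, i⟩) (.inr ⟨f, j⟩) = w (.inr ⟨e, 0⟩) (.inr ⟨f, 0⟩) := by
  rw [← hw.mid_mul_path h e f i j]
  conv_rhs => rw [← hw.isMagicUnitary.sum_mul_row (.inr ⟨e, i⟩)
    (w (.inr ⟨e, 0⟩) (.inr ⟨f, 0⟩))]
  symm
  refine Fintype.sum_eq_single (α := V ⊕ Σ e : H.SubdividedEdge c₀, Fin (m (H.ecolor e.1) + 1))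
    (.inr ⟨f, j⟩) fun s hs => ?_
  refine hw.preserves_midTail h i _ _ _ _ fun h' => ?_
  obtain ⟨g, hg, h1, h2⟩ := h'.mp ⟨e, i.2, rfl, rfl⟩
  obtain ⟨rfl, -⟩ := Sigma.mk.inj (Sum.inr_injective h1)
  refine hs (h2.trans ?_)
  congr 2
  exact Fin.ext hij

theorem path_path_of_ne (hw : IsQutMatrix (.ofGraph (H.subdivide c₀ m)) w)
    (h : H.HasTails c₀ core)
    (hm : Set.InjOn m {c | c ≠ c₀ ∧ ∃ e ∈ H.graph.edgeSet, H.ecolor e = c})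
    {e f : H.SubdividedEdge c₀} (hef : H.ecolor e.1 ≠ H.ecolor f.1)
    (i : Fin (m (H.ecolor e.1) + 1)) (j : Fin (m (H.ecolor f.1) + 1)) :
    w (.inr ⟨e, i⟩) (.inr ⟨f, j⟩) = 0 := by
  rw [← hw.mid_mul_path h e f i j, hw.mid_mid_of_ne h hm hef, zero_mul]

theorem isMagicUnitary_restrict (hw : IsQutMatrix (.ofGraph (H.subdivide c₀ m)) w)
    (h : H.HasTails c₀ core) : IsMagicUnitary (w.submatrix Sum.inl Sum.inl) where
  star_eq _ _ := hw.star_eq _ _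
  idem _ _ := hw.idem _ _
  row x := by
    rw [← hw.row (.inl x), Fintype.sum_sum_type]
    simp [hw.inl_inr h]
  col x := by
    rw [← hw.col (.inl x), Fintype.sum_sum_type]
    simp [hw.inr_inl h]

theorem preservesPred_midColor (hw : IsQutMatrix (.ofGraph (H.subdivide c₀ m)) w)
    (h : H.HasTails c₀ core)
    (hm : Set.InjOn m {c | c ≠ c₀ ∧ ∃ e ∈ H.graph.edgeSet, H.ecolor e = c}) (c : CE) :
    PreservesPred w fun s => ∃ e : H.SubdividedEdge c₀, H.ecolor e.1 = c ∧ s = .inr ⟨e, 0⟩ := by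
  have key : ∀ {v : Matrix (V ⊕ Σ e : H.SubdividedEdge c₀, Fin (m (H.ecolor e.1) + 1))
      (V ⊕ Σ e : H.SubdividedEdge c₀, Fin (m (H.ecolor e.1) + 1)) B},
      IsQutMatrix (.ofGraph (H.subdivide c₀ m)) v → ∀ s t,
      (∃ e : H.SubdividedEdge c₀, H.ecolor e.1 = c ∧ s = .inr ⟨e, 0⟩) →
      (¬ ∃ e : H.SubdividedEdge c₀, H.ecolor e.1 = c ∧ t = .inr ⟨e, 0⟩) → v s t = 0 := by
    rintro v hv _ t ⟨e, hec, rfl⟩ ht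
    rcases t with x | ⟨f, j⟩
    · exact hv.inr_inl h _ _
    · by_cases hef : H.ecolor e.1 = H.ecolor f.1
      · refine hv.inr_inr_of_ne h fun h0 => ht ⟨f, hef.symm.trans hec, ?_⟩
        congr 2
        exact Fin.ext h0.symm
      · exact hv.path_path_of_ne h hm hef _ _
  intro s t hst
  by_cases hs : ∃ e : H.SubdividedEdge c₀, H.ecolor e.1 = c ∧ s = .inr ⟨e, 0⟩
  · exact key hw s t hs fun ht => hst (iff_of_true hs ht)
  · exact key hw.transpose t s (by_contra fun ht => hst (iff_of_false hs ht)) hs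

/-- Expresses a subdivided color through invariant relations, as a walk of length two through a
subdividing vertex of that color. The condition that the ends differ excludes walking back along the
same half edge. -/
theorem _root_.ColoredGraph.isEdge_iff_exists_mid {c : CE} (hc : c ≠ c₀) (x y : V) :
    H.IsEdge c x y ↔ ((Sum.inl x : V ⊕ Σ e : H.SubdividedEdge c₀, Fin (m (H.ecolor e.1) + 1)) ≠
      .inl y ∧ ∃ s, ((H.subdivide c₀ m).Adj (.inl x) s ∧
        ∃ e : H.SubdividedEdge c₀, H.ecolor e.1 = c ∧ s = .inr ⟨e, 0⟩) ∧
        (H.subdivide c₀ m).Adj s (.inl y)) := by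
  constructor
  · rintro ⟨h1, h2⟩
    refine ⟨fun h => h1.ne (Sum.inl_injective h), .inr ⟨⟨s(x, y), h1, by rwa [h2]⟩, 0⟩,
      ⟨⟨Sym2.mem_mk_left _ _, rfl⟩, _, h2, rfl⟩, ⟨Sym2.mem_mk_right _ _, rfl⟩⟩
  · rintro ⟨hne, _, ⟨hx, e, hec, rfl⟩, hy⟩
    have hxy : e.1 = s(x, y) :=
      (Sym2.mem_and_mem_iff fun h => hne (congrArg _ h)).mp ⟨hx.1, hy.1⟩
    have := e.2.1
    rw [hxy] at this hec
    exact ⟨this, hec⟩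

/-- Between old vertices, color `c₀` is adjacency itself; the other colors are covered by
`isEdge_iff_exists_mid`. -/
theorem isQutMatrix_restrict (hw : IsQutMatrix (.ofGraph (H.subdivide c₀ m)) w)
    (h : H.HasTails c₀ core)
    (hm : Set.InjOn m {c | c ≠ c₀ ∧ ∃ e ∈ H.graph.edgeSet, H.ecolor e = c})
    (hv : ∀ x y, H.vcolor x = H.vcolor y) : IsQutMatrix H (w.submatrix Sum.inl Sum.inl) := by
  refine (hw.isMagicUnitary_restrict h).isQutMatrix (fun x y hxy => absurd (hv x y) hxy) fun c => ?_
  by_cases hc : c = c₀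
  · subst hc
    exact fun x y a b hn => hw.preserves_adj _ _ _ _ hn
  · intro x y a b hn
    rw [isEdge_iff_exists_mid (m := m) hc, isEdge_iff_exists_mid (m := m) hc] at hn
    exact (hw.isMagicUnitary.preserves_eq.not.and (hw.isMagicUnitary.preserves_comp
      (hw.preserves_adj.and (hw.preservesPred_midColor h hm c).right) hw.preserves_adj))
      (.inl x) (.inl y) (.inl a) (.inl b) hn

/-! ### The entry at two subdividing vertices in terms of the endpoints -/

section Edge

variable {e f : H.SubdividedEdge c₀} {a b p q : V}

theorem mid_mul_inl (hw : IsQutMatrix (.ofGraph (H.subdivide c₀ m)) w)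
    {x y : V} (hxy : ¬(x ∈ e.1 ↔ y ∈ f.1)) :
    w (.inr ⟨e, 0⟩) (.inr ⟨f, 0⟩) * w (.inl x) (.inl y) = 0 := by
  refine hw.preserves_adj _ _ _ _ fun h' => hxy ?_
  exact ⟨fun hx => (h'.mp ⟨hx, rfl⟩).1, fun hy => (h'.mpr ⟨hy, rfl⟩).1⟩

theorem mid_mul_add_row (hw : IsQutMatrix (.ofGraph (H.subdivide c₀ m)) w)
    (h : H.HasTails c₀ core) (ha : a ∈ e.1) (hf : f.1 = s(p, q)) (hpq : p ≠ q) :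
    w (.inr ⟨e, 0⟩) (.inr ⟨f, 0⟩) * w (.inl a) (.inl p) +
      w (.inr ⟨e, 0⟩) (.inr ⟨f, 0⟩) * w (.inl a) (.inl q) = w (.inr ⟨e, 0⟩) (.inr ⟨f, 0⟩) := by
  conv_rhs => rw [← (hw.isMagicUnitary_restrict h).sum_mul_row a (w (.inr ⟨e, 0⟩) (.inr ⟨f, 0⟩))]
  symm
  refine Fintype.sum_eq_add p q hpq fun y hy => ?_
  refine hw.mid_mul_inl fun h' => ?_
  have := h'.mp ha
  rw [hf, Sym2.mem_iff] at this
  tauto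

/-- With `W` the entry at the subdividing vertices, row `a` gives `W * w a p + W * w a q = W` and
column `q` gives `W * w a q + W * w b q = W`; cancel the common term. -/
theorem mid_mul_inl_eq (hw : IsQutMatrix (.ofGraph (H.subdivide c₀ m)) w)
    (h : H.HasTails c₀ core) (he : e.1 = s(a, b)) (hab : a ≠ b) (hf : f.1 = s(p, q))
    (hpq : p ≠ q) :
    w (.inr ⟨e, 0⟩) (.inr ⟨f, 0⟩) * w (.inl a) (.inl p) =
      w (.inr ⟨e, 0⟩) (.inr ⟨f, 0⟩) * w (.inl b) (.inl q) := by
  have h1 := hw.mid_mul_add_row h (e := e) (a := a) (by simp [he]) hf hpq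
  have h2 := hw.transpose.mid_mul_add_row h (e := f) (a := q) (by simp [hf]) he hab
  simp only [Matrix.transpose_apply] at h2
  have h3 := h1.trans h2.symm
  rw [add_comm] at h3
  exact add_left_cancel h3

theorem inl_mul_mid_eq_zero (hw : IsQutMatrix (.ofGraph (H.subdivide c₀ m)) w)
    (h : H.HasTails c₀ core) (ha : a ∈ e.1)
    {s : V ⊕ Σ e : H.SubdividedEdge c₀, Fin (m (H.ecolor e.1) + 1)}
    (hs : ¬ ∃ g : H.SubdividedEdge c₀, p ∈ g.1 ∧ s = .inr ⟨g, 0⟩) :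
    w (.inl a) (.inl p) * w (.inr ⟨e, 0⟩) s = 0 := by
  rcases s with x | ⟨g, j⟩
  · rw [hw.inr_inl h, mul_zero]
  · refine hw.preserves_adj _ _ _ _ fun h' => hs ⟨g, ?_⟩
    have h2 := h'.mp ⟨ha, rfl⟩
    refine ⟨h2.1, ?_⟩
    congr 2
    exact Fin.ext h2.2

/-- Expand by the row sum of `(e, 0)`. A surviving index must be a subdividing vertex adjacent to
both `p` and `q`, and the graph being simple there is only `(f, 0)`. -/
theorem inl_mul_mid_mul_inl (hw : IsQutMatrix (.ofGraph (H.subdivide c₀ m)) w)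
    (h : H.HasTails c₀ core) (he : e.1 = s(a, b)) (hf : f.1 = s(p, q)) (hpq : p ≠ q) :
    w (.inl a) (.inl p) * w (.inr ⟨e, 0⟩) (.inr ⟨f, 0⟩) * w (.inl b) (.inl q) =
      w (.inl a) (.inl p) * w (.inl b) (.inl q) := by
  conv_rhs => rw [← hw.isMagicUnitary.sum_mul_row (.inr ⟨e, 0⟩) (w (.inl a) (.inl p)),
    Finset.sum_mul]
  symm
  refine Fintype.sum_eq_single (α := V ⊕ Σ e : H.SubdividedEdge c₀, Fin (m (H.ecolor e.1) + 1))
    (.inr ⟨f, 0⟩) fun s hs => ?_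
  by_cases h1 : ∃ g : H.SubdividedEdge c₀, p ∈ g.1 ∧ s = .inr ⟨g, 0⟩
  · rw [mul_assoc, hw.isMagicUnitary.mul_eq_zero_symm
      (hw.inl_mul_mid_eq_zero h (p := q) (a := b) (by simp [he]) ?_), mul_zero]
    rintro ⟨g, hg, rfl⟩
    obtain ⟨g', hg', h2⟩ := h1
    obtain ⟨rfl, -⟩ := Sigma.mk.inj (Sum.inr_injective h2)
    refine hs ?_
    have : g = f := Subtype.ext (((Sym2.mem_and_mem_iff hpq).mp ⟨hg', hg⟩).trans hf.symm)
    rw [this]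
  · rw [hw.inl_mul_mid_eq_zero h (by simp [he]) h1, zero_mul]

/-- By the two preceding identities the product equals `w a p * W * w a p`, which is self-adjoint; a
self-adjoint product of self-adjoint elements is a commuting one. -/
theorem inl_commute (hw : IsQutMatrix (.ofGraph (H.subdivide c₀ m)) w)
    (h : H.HasTails c₀ core) (he : e.1 = s(a, b)) (hab : a ≠ b) (hf : f.1 = s(p, q))
    (hpq : p ≠ q) :
    w (.inl a) (.inl p) * w (.inl b) (.inl q) = w (.inl b) (.inl q) * w (.inl a) (.inl p) := by
  have h1 := hw.inl_mul_mid_mul_inl h he hf hpq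
  rw [mul_assoc, ← hw.mid_mul_inl_eq h he hab hf hpq] at h1
  have h2 := congrArg star h1
  simp only [star_mul, hw.star_eq] at h2
  rw [← h1, ← h2, mul_assoc]

theorem mid_mul_eq (hw : IsQutMatrix (.ofGraph (H.subdivide c₀ m)) w)
    (h : H.HasTails c₀ core) (he : e.1 = s(a, b)) (hab : a ≠ b) (hf : f.1 = s(p, q))
    (hpq : p ≠ q) :
    w (.inr ⟨e, 0⟩) (.inr ⟨f, 0⟩) * w (.inl a) (.inl p) =
      w (.inl a) (.inl p) * w (.inl b) (.inl q) := by
  have hc := hw.inl_commute h he hab hf hpq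
  have h1 := hw.mid_mul_inl_eq h he hab hf hpq
  have h2 : w (.inr ⟨e, 0⟩) (.inr ⟨f, 0⟩) * (w (.inl a) (.inl p) * w (.inl b) (.inl q)) =
      w (.inl a) (.inl p) * w (.inl b) (.inl q) := by
    conv_rhs => rw [← one_mul (w (.inl a) (.inl p) * w (.inl b) (.inl q)),
      ← hw.row (.inr ⟨e, 0⟩), Finset.sum_mul]
    symm
    refine Fintype.sum_eq_single (α := V ⊕ Σ e : H.SubdividedEdge c₀, Fin (m (H.ecolor e.1) + 1))
      (.inr ⟨f, 0⟩) fun s hs => ?_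
    by_cases h1 : ∃ g : H.SubdividedEdge c₀, p ∈ g.1 ∧ s = .inr ⟨g, 0⟩
    -- Commutation puts the factor at `b`, `q` next to the subdividing entry, so that adjacency to
    -- `q` can be tested as well.
    · rw [hc, ← mul_assoc, hw.isMagicUnitary.mul_eq_zero_symm
        (hw.inl_mul_mid_eq_zero h (p := q) (a := b) (by simp [he]) ?_), zero_mul]
      rintro ⟨g, hg, rfl⟩
      obtain ⟨g', hg', h2⟩ := h1
      obtain ⟨rfl, -⟩ := Sigma.mk.inj (Sum.inr_injective h2)
      refine hs ?_
      have : g = f := Subtype.ext (((Sym2.mem_and_mem_iff hpq).mp ⟨hg', hg⟩).trans hf.symm)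
      rw [this]
    · rw [← mul_assoc, hw.isMagicUnitary.mul_eq_zero_symm
        (hw.inl_mul_mid_eq_zero h (by simp [he]) h1), zero_mul]
  rw [← h2, ← mul_assoc, h1, mul_assoc, hw.idem]

theorem mid_mid_eq (hw : IsQutMatrix (.ofGraph (H.subdivide c₀ m)) w)
    (h : H.HasTails c₀ core) (he : e.1 = s(a, b)) (hab : a ≠ b) (hf : f.1 = s(p, q))
    (hpq : p ≠ q) :
    w (.inr ⟨e, 0⟩) (.inr ⟨f, 0⟩) = w (.inl a) (.inl p) * w (.inl b) (.inl q) +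
      w (.inl a) (.inl q) * w (.inl b) (.inl p) := by
  rw [← hw.mid_mul_eq h he hab hf hpq,
    ← hw.mid_mul_eq h he hab (hf.trans Sym2.eq_swap) hpq.symm]
  exact (hw.mid_mul_add_row h (by simp [he]) hf hpq).symm

end Edge

theorem edgeCommute_restrict (hw : IsQutMatrix (.ofGraph (H.subdivide c₀ m)) w)
    (h : H.HasTails c₀ core) : EdgeCommute H c₀ (w.submatrix Sum.inl Sum.inl) := by
  intro c hc a b p q hab hpq
  exact hw.inl_commute h (e := ⟨s(a, b), hab.1, by rw [hab.2]; exact hc⟩)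
    (f := ⟨s(p, q), hpq.1, by rw [hpq.2]; exact hc⟩) rfl hab.1.ne rfl hpq.1.ne

end IsQutMatrix

end Restrict

/-! ### Extension of magic unitaries to the subdivided graph -/

section Extend

variable {V : Type u} [Fintype V] {CV CE : Type*} {H : ColoredGraph V CV CE} {c₀ : CE}
  {B : Type*} [CStarAlgebra B] {w : Matrix V V B}

open Classical in
/-- The entry at the edges `s(a, b)` and `f`: the sum of `w a p * w b q` over `s(p, q) = f`. -/
def edgeEntry (w : Matrix V V B) (a b : V) (f : Sym2 V) : B :=
  ∑ p, ∑ q, if s(p, q) = f then w a p * w b q else 0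

theorem edgeEntry_mk (w : Matrix V V B) (a b : V) {p q : V} (hpq : p ≠ q) :
    edgeEntry w a b s(p, q) = w a p * w b q + w a q * w b p := by
  classical
  rw [edgeEntry, Fintype.sum_eq_add p q hpq, Fintype.sum_eq_single q, Fintype.sum_eq_single p,
    if_pos rfl, if_pos Sym2.eq_swap]
  · rintro y hy
    refine if_neg fun h => ?_
    rcases Sym2.eq_iff.mp h with h | h
    · exact hy (h.2.trans h.1)
    · exact hy h.2
  · rintro y hy
    refine if_neg fun h => ?_
    rcases Sym2.eq_iff.mp h with h | h
    · exact hy h.2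
    · exact hy (h.2.trans h.1)
  · rintro x ⟨h1, h2⟩
    refine Finset.sum_eq_zero fun y _ => if_neg fun h => ?_
    rcases Sym2.eq_iff.mp h with h | h
    · exact h1 h.1
    · exact h2 h.1

open Classical in
/-- The matrix over the subdivided graph induced by a matrix over the original graph. -/
def extendMatrix (H : ColoredGraph V CV CE) (c₀ : CE) (m : CE → ℕ) (w : Matrix V V B) :
    Matrix (V ⊕ Σ e : H.SubdividedEdge c₀, Fin (m (H.ecolor e.1) + 1))
      (V ⊕ Σ e : H.SubdividedEdge c₀, Fin (m (H.ecolor e.1) + 1)) B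
  | .inl x, .inl y => w x y
  | .inl _, .inr _ => 0
  | .inr _, .inl _ => 0
  | .inr p, .inr q => if H.ecolor p.1.1 = H.ecolor q.1.1 ∧ (p.2 : ℕ) = q.2 then
      edgeEntry w p.1.1.out.1 p.1.1.out.2 q.1.1 else 0

variable {m : CE → ℕ}

/-- `Quot.out` may return the endpoints of `e` in either order. Exchanging them reverses the order
of the factors, and edge commutation repairs this. -/
theorem edgeEntry_out (hc : EdgeCommute H c₀ w) {e f : H.SubdividedEdge c₀}
    (hef : H.ecolor e.1 = H.ecolor f.1) {a b p q : V} (he : e.1 = s(a, b)) (hf : f.1 = s(p, q)) :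
    edgeEntry w e.1.out.1 e.1.out.2 f.1 = w a p * w b q + w a q * w b p := by
  have hf1 := f.2.1
  have he1 := e.2.1
  have he2 := e.2.2
  rw [hf] at hf1
  rw [he] at he1
  rw [hf, edgeEntry_mk _ _ _ (SimpleGraph.Adj.ne hf1)]
  have h1 : s(e.1.out.1, e.1.out.2) = s(a, b) := (Quot.out_eq e.1).trans he
  rcases Sym2.eq_iff.mp h1 with ⟨h2, h3⟩ | ⟨h2, h3⟩
  · rw [h2, h3]
  · rw [h2, h3]
    have hab : H.IsEdge (H.ecolor e.1) a b := ⟨he1, by rw [he]⟩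
    have hpq : H.IsEdge (H.ecolor e.1) p q := ⟨hf1, by rw [hef, hf]⟩
    rw [← hc _ he2 _ _ _ _ hab hpq, ← hc _ he2 _ _ _ _ hab (H.isEdge_symm hpq), add_comm]

theorem extendMatrix_inr (hc : EdgeCommute H c₀ w) {e f : H.SubdividedEdge c₀}
    (hef : H.ecolor e.1 = H.ecolor f.1) {i : Fin (m (H.ecolor e.1) + 1)}
    {j : Fin (m (H.ecolor f.1) + 1)} (hij : (i : ℕ) = j)
    {a b p q : V} (he : e.1 = s(a, b)) (hf : f.1 = s(p, q)) :
    extendMatrix H c₀ m w (.inr ⟨e, i⟩) (.inr ⟨f, j⟩) = w a p * w b q + w a q * w b p :=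
  (if_pos ⟨hef, hij⟩).trans (edgeEntry_out hc hef he hf)

theorem extendMatrix_inr_of_not {p q : Σ e : H.SubdividedEdge c₀, Fin (m (H.ecolor e.1) + 1)}
    (h : ¬(H.ecolor p.1.1 = H.ecolor q.1.1 ∧ (p.2 : ℕ) = q.2)) :
    extendMatrix H c₀ m w (.inr p) (.inr q) = 0 := if_neg h

theorem EdgeCommute.transpose (hc : EdgeCommute H c₀ w) : EdgeCommute H c₀ w.transpose :=
  fun c hcc i j k l hij hkl => hc c hcc k l i j hkl hij

theorem extendMatrix_transpose (hc : EdgeCommute H c₀ w) :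
    extendMatrix H c₀ m w.transpose = (extendMatrix H c₀ m w).transpose := by
  ext (x | ⟨e, i⟩) (y | ⟨f, j⟩)
  · rfl
  · rfl
  · rfl
  · rw [Matrix.transpose_apply]
    by_cases h : H.ecolor e.1 = H.ecolor f.1 ∧ (i : ℕ) = j
    · obtain ⟨a, b, he, hab, hce⟩ := e.exists_eq
      obtain ⟨p, q, hf, hpq, hcf⟩ := f.exists_eq
      rw [extendMatrix_inr hc.transpose h.1 h.2 he hf, extendMatrix_inr hc h.1.symm h.2.symm hf he]
      simp only [Matrix.transpose_apply]
      have h2 : H.ecolor s(a, b) = H.ecolor s(p, q) := by rw [← he, ← hf]; exact h.1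
      rw [hc _ hcf q p a b ⟨hpq.symm, by rw [Sym2.eq_swap]⟩ ⟨hab, h2⟩]
    · rw [extendMatrix_inr_of_not h, extendMatrix_inr_of_not fun h' => h ⟨h'.1.symm, h'.2.symm⟩]

namespace IsQutMatrix

/-- The unrestricted double sum is a product of two row sums, and its terms at pairs that are not
edges of color `c` vanish. -/
theorem sum_edgeEntry (hw : IsQutMatrix H w) {c : CE} {a b : V} (hab : H.IsEdge c a b) :
    ∑ p, ∑ q, (open Classical in if H.IsEdge c p q then w a p * w b q else 0) = 1 := by
  classical
  rw [← hw.row a]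
  refine Finset.sum_congr rfl fun p _ => ?_
  conv_rhs => rw [← hw.isMagicUnitary.sum_mul_row b (w a p)]
  refine Finset.sum_congr rfl fun q _ => ?_
  split_ifs with h
  · rfl
  · exact (hw.mul_eq_zero_of_isEdge hab h).symm

theorem row_extendMatrix (hw : IsQutMatrix H w)
    (s : V ⊕ Σ e : H.SubdividedEdge c₀, Fin (m (H.ecolor e.1) + 1)) :
    ∑ t, extendMatrix H c₀ m w s t = 1 := by
  classical
  rw [Fintype.sum_sum_type]
  rcases s with x | ⟨e, i⟩
  · simp only [extendMatrix, Finset.sum_const_zero, add_zero, hw.row]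
  · simp only [extendMatrix, Finset.sum_const_zero, zero_add]
    rw [Fintype.sum_sigma]
    have h1 : ∀ f : H.SubdividedEdge c₀, (∑ j : Fin (m (H.ecolor f.1) + 1),
        if H.ecolor e.1 = H.ecolor f.1 ∧ (i : ℕ) = j then
          edgeEntry w e.1.out.1 e.1.out.2 f.1 else 0) =
        if H.ecolor e.1 = H.ecolor f.1 then edgeEntry w e.1.out.1 e.1.out.2 f.1 else 0 := by
      intro f
      by_cases hef : H.ecolor e.1 = H.ecolor f.1
      -- Edges of the same color carry paths of the same length, so the path at `f` has exactly one
      -- vertex at distance `i`.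
      · rw [if_pos hef, Fintype.sum_eq_single ⟨i, by rw [← hef]; exact i.2⟩, if_pos ⟨hef, rfl⟩]
        intro j hj
        exact if_neg fun h => hj (Fin.ext h.2.symm)
      · rw [if_neg hef]
        exact Finset.sum_eq_zero fun j _ => if_neg fun h => hef h.1
    rw [Finset.sum_congr rfl fun f _ => h1 f]
    have hab : H.IsEdge (H.ecolor e.1) e.1.out.1 e.1.out.2 := by
      have h2 : s(e.1.out.1, e.1.out.2) = e.1 := Quot.out_eq e.1
      exact ⟨by have := e.2.1; rwa [← h2] at this, by rw [h2]⟩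
    rw [← hw.sum_edgeEntry hab]
    have h3 : ∀ f : H.SubdividedEdge c₀,
        (if H.ecolor e.1 = H.ecolor f.1 then edgeEntry w e.1.out.1 e.1.out.2 f.1 else 0) =
        ∑ p, ∑ q, if H.ecolor e.1 = H.ecolor f.1 ∧ s(p, q) = f.1 then
          w e.1.out.1 p * w e.1.out.2 q else 0 := by
      intro f
      by_cases hef : H.ecolor e.1 = H.ecolor f.1
      · simp only [hef, if_true, true_and]
        unfold edgeEntry
        congr!
      · simp [hef]
    rw [Finset.sum_congr rfl fun f _ => h3 f, Finset.sum_comm]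
    refine Finset.sum_congr rfl fun p _ => ?_
    rw [Finset.sum_comm]
    refine Finset.sum_congr rfl fun q _ => ?_
    -- After the sums are exchanged, an ordered pair contributes to exactly one subdivided edge if
    -- it is an edge of the right color, and to none otherwise.
    by_cases hpq : H.IsEdge (H.ecolor e.1) p q
    · rw [if_pos hpq, Fintype.sum_eq_single ⟨s(p, q), hpq.1, by rw [hpq.2]; exact e.2.2⟩,
        if_pos ⟨hpq.2.symm, rfl⟩]
      exact fun f hf => if_neg fun h => hf (Subtype.ext h.2.symm)
    · rw [if_neg hpq]
      refine Finset.sum_eq_zero fun f _ => if_neg fun h => hpq ?_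
      have := f.2.1
      rw [← h.2] at this
      exact ⟨this, by rw [h.1, h.2]⟩

/-- Each summand `w a p * w b q` is a product of commuting projections, and the two summands are
orthogonal since `p ≠ q`. The column sums are row sums of the transpose. -/
theorem isMagicUnitary_extendMatrix (hw : IsQutMatrix H w) (hc : EdgeCommute H c₀ w) :
    IsMagicUnitary (extendMatrix H c₀ m w) where
  star_eq := by
    rintro (x | ⟨e, i⟩) (y | ⟨f, j⟩)
    · exact hw.star_eq x y
    · exact star_zero B
    · exact star_zero B
    · by_cases h : H.ecolor e.1 = H.ecolor f.1 ∧ (i : ℕ) = j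
      · obtain ⟨a, b, he, hab, hce⟩ := e.exists_eq
        obtain ⟨p, q, hf, hpq, hcf⟩ := f.exists_eq
        have h2 : H.ecolor s(a, b) = H.ecolor s(p, q) := by rw [← he, ← hf]; exact h.1
        rw [extendMatrix_inr hc h.1 h.2 he hf]
        simp only [star_add, star_mul, hw.star_eq]
        rw [hc _ hcf a b p q ⟨hab, h2⟩ ⟨hpq, rfl⟩,
          hc _ hcf a b q p ⟨hab, h2⟩ ⟨hpq.symm, by rw [Sym2.eq_swap]⟩]
      · rw [extendMatrix_inr_of_not h, star_zero]
  idem := by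
    rintro (x | ⟨e, i⟩) (y | ⟨f, j⟩)
    · exact hw.idem x y
    · exact mul_zero _
    · exact mul_zero _
    · by_cases h : H.ecolor e.1 = H.ecolor f.1 ∧ (i : ℕ) = j
      · obtain ⟨a, b, he, hab, hce⟩ := e.exists_eq
        obtain ⟨p, q, hf, hpq, hcf⟩ := f.exists_eq
        have h2 : H.ecolor s(a, b) = H.ecolor s(p, q) := by rw [← he, ← hf]; exact h.1
        rw [extendMatrix_inr hc h.1 h.2 he hf]
        have c1 := hc _ hcf a b p q ⟨hab, h2⟩ ⟨hpq, rfl⟩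
        have c2 := hc _ hcf a b q p ⟨hab, h2⟩ ⟨hpq.symm, by rw [Sym2.eq_swap]⟩
        have s1 : ∀ x y : V, w a x * w b y = w b y * w a x →
            w a x * w b y * (w a x * w b y) = w a x * w b y := fun x y hxy => by
          rw [mul_assoc, ← mul_assoc (w b y), ← hxy, mul_assoc, hw.idem, ← mul_assoc, hw.idem]
        have s2 : ∀ x y : V, x ≠ y → w a x * w b y = w b y * w a x →
            w a x * w b y * (w a y * w b x) = 0 := fun x y hne hxy => by
          rw [hxy, mul_assoc, ← mul_assoc (w a x), hw.row_orthogonal a hne, zero_mul, mul_zero]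
        rw [add_mul, mul_add, mul_add, s1 p q c1, s1 q p c2, s2 p q hpq.ne c1, s2 q p hpq.ne.symm c2,
          add_zero, zero_add]
      · rw [extendMatrix_inr_of_not h, mul_zero]
  row := hw.row_extendMatrix
  col s := by
    have := hw.transpose.row_extendMatrix (c₀ := c₀) (m := m) s
    rwa [extendMatrix_transpose hc] at this

theorem extendMatrix_mul_eq_zero (hw : IsQutMatrix H w) (hc : EdgeCommute H c₀ w)
    {s t s' t' : V ⊕ Σ e : H.SubdividedEdge c₀, Fin (m (H.ecolor e.1) + 1)}
    (h1 : (H.subdivide c₀ m).Adj s t) (h2 : ¬ (H.subdivide c₀ m).Adj s' t') :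
    extendMatrix H c₀ m w s s' * extendMatrix H c₀ m w t t' = 0 := by
  have hM := hw.isMagicUnitary_extendMatrix (m := m) hc
  have key : ∀ (x x' : V) (p p' : Σ e : H.SubdividedEdge c₀, Fin (m (H.ecolor e.1) + 1)),
      (x ∈ p.1.1 ∧ (p.2 : ℕ) = 0) → ¬ (x' ∈ p'.1.1 ∧ (p'.2 : ℕ) = 0) →
      extendMatrix H c₀ m w (.inl x) (.inl x') * extendMatrix H c₀ m w (.inr p) (.inr p') = 0 := by
    rintro x x' ⟨e, i⟩ ⟨f, j⟩ ⟨hx, hi⟩ hn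
    by_cases h : H.ecolor e.1 = H.ecolor f.1 ∧ (i : ℕ) = j
    · obtain ⟨b, he, hab, hce⟩ := ColoredGraph.SubdividedEdge.exists_eq_of_mem hx
      obtain ⟨p, q, hf, hpq, hcf⟩ := f.exists_eq
      rw [extendMatrix_inr hc h.1 h.2 he hf]
      have hx' : x' ∉ f.1 := fun h' => hn ⟨h', h.2.symm.trans hi⟩
      rw [hf, Sym2.mem_iff, not_or] at hx'
      change w x x' * _ = 0
      rw [mul_add, ← mul_assoc, ← mul_assoc, hw.row_orthogonal x hx'.1, hw.row_orthogonal x hx'.2,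
        zero_mul, zero_mul, add_zero]
    · rw [extendMatrix_inr_of_not h, mul_zero]
  rcases s with x | ⟨e, i⟩ <;> rcases s' with x' | ⟨e', i'⟩
  · rcases t with y | ⟨f, j⟩ <;> rcases t' with y' | ⟨f', j'⟩
    · exact hw.mul_eq_zero_of_isEdge h1 h2
    · exact mul_zero _
    · exact mul_zero _
    · exact key _ _ _ _ h1 h2
  · exact zero_mul _
  · exact zero_mul _
  · rcases t with y | ⟨f, j⟩ <;> rcases t' with y' | ⟨f', j'⟩
    · exact hM.mul_eq_zero_symm (key _ _ _ _ h1 h2)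
    · exact mul_zero _
    · exact mul_zero _
    · obtain ⟨hef, hij⟩ := h1
      simp only at hef hij
      subst hef
      by_cases hi : H.ecolor e.1 = H.ecolor e'.1 ∧ (i : ℕ) = i'
      · by_cases hj : H.ecolor e.1 = H.ecolor f'.1 ∧ (j : ℕ) = j'
        -- If the target edges agreed, equal distances would make the targets adjacent. As they
        -- differ, the product vanishes by row orthogonality at distance zero, and entries do not
        -- depend on the distance.
        · have hne : (Sum.inr ⟨e', 0⟩ : V ⊕ Σ e : H.SubdividedEdge c₀,
              Fin (m (H.ecolor e.1) + 1)) ≠ .inr ⟨f', 0⟩ := by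
            intro h'
            obtain ⟨rfl, -⟩ := Sigma.mk.inj (Sum.inr_injective h')
            refine h2 ⟨rfl, ?_⟩
            change (i' : ℕ) + 1 = j' ∨ (j' : ℕ) + 1 = i'
            omega
          have := hM.row_orthogonal (.inr ⟨e, 0⟩) hne
          obtain ⟨a, b, he, -⟩ := e.exists_eq
          obtain ⟨p, q, hf, -⟩ := e'.exists_eq
          obtain ⟨p', q', hf', -⟩ := f'.exists_eq
          rw [extendMatrix_inr hc hi.1 rfl he hf, extendMatrix_inr hc hj.1 rfl he hf'] at this
          rw [extendMatrix_inr hc hi.1 hi.2 he hf, extendMatrix_inr hc hj.1 hj.2 he hf', this]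
        · rw [extendMatrix_inr_of_not (p := ⟨e, j⟩) (q := ⟨f', j'⟩) hj, mul_zero]
      · rw [extendMatrix_inr_of_not (p := ⟨e, i⟩) (q := ⟨e', i'⟩) hi, zero_mul]

theorem isQutMatrix_extendMatrix (hw : IsQutMatrix H w) (hc : EdgeCommute H c₀ w) :
    IsQutMatrix (.ofGraph (H.subdivide c₀ m)) (extendMatrix H c₀ m w) := by
  refine (hw.isMagicUnitary_extendMatrix hc).isQutMatrix (fun _ _ h => absurd rfl h) fun _ => ?_
  refine Preserves.congr (R := (H.subdivide c₀ m).Adj) ?_ fun s t => (and_iff_left rfl).symm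
  intro s t s' t' hn
  by_cases h : (H.subdivide c₀ m).Adj s t
  · exact hw.extendMatrix_mul_eq_zero hc h fun h' => hn (iff_of_true h h')
  · have := hw.transpose.extendMatrix_mul_eq_zero (m := m) hc.transpose
      (by_contra fun h' => hn (iff_of_false h h')) h
    rwa [extendMatrix_transpose hc] at this

/-- Every magic unitary that commutes with the subdivided graph is an extension. -/
theorem extendMatrix_restrict {core : V → Prop}
    {u : Matrix (V ⊕ Σ e : H.SubdividedEdge c₀, Fin (m (H.ecolor e.1) + 1))
      (V ⊕ Σ e : H.SubdividedEdge c₀, Fin (m (H.ecolor e.1) + 1)) B}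
    (hu : IsQutMatrix (.ofGraph (H.subdivide c₀ m)) u) (h : H.HasTails c₀ core)
    (hm : Set.InjOn m {c | c ≠ c₀ ∧ ∃ e ∈ H.graph.edgeSet, H.ecolor e = c}) :
    extendMatrix H c₀ m (u.submatrix Sum.inl Sum.inl) = u := by
  ext (x | ⟨e, i⟩) (y | ⟨f, j⟩)
  · rfl
  · exact (hu.inl_inr h x _).symm
  · exact (hu.inr_inl h _ y).symm
  · by_cases hef : H.ecolor e.1 = H.ecolor f.1
    · by_cases hij : (i : ℕ) = j
      · obtain ⟨a, b, he, hab, -⟩ := e.exists_eq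
        obtain ⟨p, q, hf, hpq, -⟩ := f.exists_eq
        rw [extendMatrix_inr (hu.edgeCommute_restrict h) hef hij he hf, hu.path_path h hij,
          hu.mid_mid_eq h he hab.ne hf hpq.ne]
        rfl
      · rw [extendMatrix_inr_of_not fun h' => hij h'.2, hu.inr_inr_of_ne h hij]
    · rw [extendMatrix_inr_of_not fun h' => hef h'.1, hu.path_path_of_ne h hm hef]

end IsQutMatrix

theorem map_extendMatrix {C : Type*} [CStarAlgebra C] (φ : B →⋆ₐ[ℂ] C) (w : Matrix V V B)
    (s t : V ⊕ Σ e : H.SubdividedEdge c₀, Fin (m (H.ecolor e.1) + 1)) :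
    φ (extendMatrix H c₀ m w s t) = extendMatrix H c₀ m (w.map φ) s t := by
  rcases s with x | ⟨e, i⟩ <;> rcases t with y | ⟨f, j⟩ <;>
    simp [extendMatrix, edgeEntry, apply_ite φ]

end Extend

/-! ### The isomorphism -/

theorem UniversalCStar.hom_ext {X : Type u} {rel : FreeStar X → FreeStar X → Prop}
    (h : IsBoundedRel rel) {B : Type*} [CStarAlgebra B] {φ ψ : UniversalCStar rel h →⋆ₐ[ℂ] B}
    (hgen : ∀ x, φ (gen h x) = ψ (gen h x)) : φ = ψ := by
  have hφ : Continuous φ := AddMonoidHomClass.continuous_of_bound φ 1 fun a =>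
    (NonUnitalStarAlgHom.norm_apply_le φ a).trans_eq (one_mul _).symm
  have hψ : Continuous ψ := AddMonoidHomClass.continuous_of_bound ψ 1 fun a =>
    (NonUnitalStarAlgHom.norm_apply_le ψ a).trans_eq (one_mul _).symm
  refine DFunLike.ext' ((denseRange_mk h).equalizer hφ hψ (funext fun a => ?_))
  simp only [Function.comp_apply]
  induction a using FreeStar.induction with
  | hg x => exact hgen x
  | h1 => simp
  | hs c a ih => rw [map_smul, map_smul, map_smul, ih]
  | ha a b h1 h2 => rw [map_add, map_add, map_add, h1, h2]
  | hm a b h1 h2 => rw [map_mul, map_mul, map_mul, h1, h2]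

section Main

open ColoredGraph

variable {V : Type u} [Fintype V] {CV CE : Type*} (H : ColoredGraph V CV CE) (c₀ : CE)
  (m : CE → ℕ) {core : V → Prop}

variable {B : Type*} [CStarAlgebra B]

/-- The *-homomorphism on `C(Qut G)` defined by a matrix that satisfies the relations. -/
def qutLift {w : Matrix V V B} (hw : IsQutMatrix H w) :
    UniversalCStar (QutRel H) (isBoundedRel_qutRel H) →⋆ₐ[ℂ] B :=
  UniversalCStar.lift _ (fun p => w p.1 p.2) (fun p => hw.star_eq p.1 p.2)
    fun _ _ h => hw.eval_eq h

/-- The *-homomorphism on `C(Qut* G)` defined by a matrix that satisfies the relations. -/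
def qutStarLift {w : Matrix V V B} (hw : IsQutMatrix H w) (hc : EdgeCommute H c₀ w) :
    UniversalCStar (QutStarRel H c₀) (isBoundedRel_qutStarRel H c₀) →⋆ₐ[ℂ] B :=
  UniversalCStar.lift _ (fun p => w p.1 p.2) (fun p => hw.star_eq p.1 p.2)
    fun _ _ h => hw.eval_eq_of_star hc h

theorem qutLift_fundMatrix {w : Matrix V V B} (hw : IsQutMatrix H w) (i j : V) :
    qutLift H hw (fundMatrix (isBoundedRel_qutRel H) i j) = w i j :=
  UniversalCStar.lift_gen _ _ _ _ (i, j)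

theorem qutStarLift_fundMatrix {w : Matrix V V B} (hw : IsQutMatrix H w)
    (hc : EdgeCommute H c₀ w) (i j : V) :
    qutStarLift H c₀ hw hc (fundMatrix (isBoundedRel_qutStarRel H c₀) i j) = w i j :=
  UniversalCStar.lift_gen _ _ _ _ (i, j)

/-- Restriction and extension of the universal matrices give `φ` and `ψ`. That they are inverse, and
that `φ` respects the comultiplication, is checked on generators. -/
theorem isIsomorphic_qut_subdivide [DecidableEq V] (h : H.HasTails c₀ core)
    (hv : ∀ x y, H.vcolor x = H.vcolor y)
    (hm : Set.InjOn m {c | c ≠ c₀ ∧ ∃ e ∈ H.graph.edgeSet, H.ecolor e = c}) :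
    (qutStar H c₀).IsIsomorphic (qut (ofGraph (H.subdivide c₀ m))) := by
  have hu := isQutMatrix_qut (ofGraph (H.subdivide c₀ m))
  have hx := isQutMatrix_qutStar H c₀
  have hxc := edgeCommute_qutStar H c₀
  let φ := qutStarLift H c₀ (hu.isQutMatrix_restrict h hm hv) (hu.edgeCommute_restrict h)
  let ψ := qutLift _ (hx.isQutMatrix_extendMatrix (m := m) hxc)
  have hφ : ∀ i j, φ (fundMatrix (isBoundedRel_qutStarRel H c₀) i j) =
      fundMatrix (isBoundedRel_qutRel (ofGraph (H.subdivide c₀ m))) (.inl i) (.inl j) :=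
    qutStarLift_fundMatrix H c₀ _ _
  have hψ : ∀ i j, ψ (fundMatrix (isBoundedRel_qutRel (ofGraph (H.subdivide c₀ m))) i j) =
      extendMatrix H c₀ m (fundMatrix (isBoundedRel_qutStarRel H c₀)) i j :=
    qutLift_fundMatrix _ _
  have hψφ : ψ.comp φ = StarAlgHom.id ℂ _ := by
    refine UniversalCStar.hom_ext _ fun p => ?_
    exact (congrArg ψ (hφ p.1 p.2)).trans (hψ _ _)
  have hφψ : φ.comp ψ = StarAlgHom.id ℂ _ := by
    refine UniversalCStar.hom_ext _ fun p => ?_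
    refine (congrArg φ (hψ p.1 p.2)).trans ?_
    rw [map_extendMatrix]
    have : (fundMatrix (isBoundedRel_qutStarRel H c₀)).map φ =
        (fundMatrix (isBoundedRel_qutRel (ofGraph (H.subdivide c₀ m)))).submatrix
          Sum.inl Sum.inl := by
      ext i j
      exact hφ i j
    rw [this, hu.extendMatrix_restrict h hm]
    rfl
  let Φ : (qutStar H c₀).C ≃⋆ₐ[ℂ] (qut (ofGraph (H.subdivide c₀ m))).C :=
    StarAlgEquiv.ofStarAlgHom φ ψ hψφ hφψ
  refine ⟨Φ, fun a => ?_⟩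
  have key : ((qut (ofGraph (H.subdivide c₀ m))).comul).comp φ =
      (MinTensor.map φ φ).comp (qutStar H c₀).comul := by
    refine UniversalCStar.hom_ext _ fun p => ?_
    have h1 : (MinTensor.map φ φ) ((qutStar H c₀).comul
        (fundMatrix (isBoundedRel_qutStarRel H c₀) p.1 p.2)) = _ :=
      congrArg (MinTensor.map φ φ) ((qutStar H c₀).comul_u p.1 p.2)
    have h2 : (qut (ofGraph (H.subdivide c₀ m))).comul
        (φ (fundMatrix (isBoundedRel_qutStarRel H c₀) p.1 p.2)) = _ :=
      (congrArg (qut (ofGraph (H.subdivide c₀ m))).comul (hφ p.1 p.2)).trans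
        ((qut (ofGraph (H.subdivide c₀ m))).comul_u (.inl p.1) (.inl p.2))
    refine h2.trans (Eq.trans ?_ h1.symm)
    refine Eq.trans ?_ (map_sum (MinTensor.map φ φ) _ _).symm
    refine (Fintype.sum_sum_type _).trans ?_
    -- The comultiplication on the subdivided graph also sums over the new vertices; these terms
    -- vanish because the matrix is block diagonal.
    have h3 : ∀ q, MinTensor.tmul ((qut (ofGraph (H.subdivide c₀ m))).u (.inl p.1) (.inr q))
        ((qut (ofGraph (H.subdivide c₀ m))).u (.inr q) (.inl p.2)) = 0 := fun q => by
      have : (qut (ofGraph (H.subdivide c₀ m))).u (.inl p.1) (.inr q) = 0 := hu.inl_inr h _ q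
      rw [this, MinTensor.zero_tmul]
    rw [Finset.sum_eq_zero fun q _ => h3 q, add_zero]
    refine Finset.sum_congr rfl fun k _ => ?_
    refine Eq.trans ?_ (MinTensor.map_tmul φ φ _ _).symm
    exact (congrArg₂ MinTensor.tmul (hφ p.1 k) (hφ k p.2)).symm
  exact DFunLike.congr_fun key a

end Main

/-! ### The graph with attached paths satisfies the degree conditions -/

section AttachPaths

variable {V : Type u} [Fintype V] {CV CE : Type*}

theorem ColoredGraph.hasTails_attachPaths (G : ColoredGraph V CV CE) [G.graph.LocallyFinite]
    (hdeg : ∀ v, 3 ≤ G.graph.degree v) (c₀ : CE) (n : CV → ℕ) :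
    (G.attachPaths n c₀).HasTails c₀ fun x => (x.2 : ℕ) = 0 := by
  have hd : ∀ v, 3 ≤ {y | G.graph.Adj v y}.ncard := fun v => by
    refine (hdeg v).trans_eq ?_
    rw [← SimpleGraph.card_neighborSet_eq_degree, ← Nat.card_eq_fintype_card]
    rfl
  have hinj : Function.Injective fun y : V => (⟨y, 0⟩ : Σ v : V, Fin (n (G.vcolor v) + 1)) :=
    fun y z h => congrArg Sigma.fst h
  have hcard : ∀ v, 3 ≤ ((fun y : V => (⟨y, 0⟩ : Σ v : V, Fin (n (G.vcolor v) + 1))) ''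
      {y | G.graph.Adj v y}).ncard := fun v => by
    rw [Set.ncard_image_of_injective _ hinj]
    exact hd v
  classical
  constructor
  · rintro ⟨v, i⟩ hi
    refine (hcard v).trans (Set.ncard_le_ncard ?_ (Set.toFinite _))
    rintro _ ⟨y, hy, rfl⟩
    exact Or.inl ⟨hy, hi, rfl⟩
  · rintro ⟨v, i⟩ z hi hz hzc
    -- The fourth neighbor is the path vertex `z`, in addition to at least three coming from `G`.
    refine le_trans ?_ (Set.ncard_le_ncard (s := insert z
      ((fun y : V => (⟨y, 0⟩ : Σ v : V, Fin (n (G.vcolor v) + 1))) '' {y | G.graph.Adj v y}))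
      ?_ (Set.toFinite _))
    · rw [Set.ncard_insert_of_notMem _ (Set.toFinite _)]
      · have := hcard v
        omega
      · rintro ⟨y, -, rfl⟩
        exact hzc rfl
    · refine Set.insert_subset hz ?_
      rintro _ ⟨y, hy, rfl⟩
      exact Or.inl ⟨hy, hi, rfl⟩
  · rintro ⟨v, i⟩ ⟨w, j⟩ hi h
    rcases h with h | ⟨h, -⟩
    · exact absurd h.2.1 hi
    · simp only at h
      subst h
      -- A path edge projects to the diagonal pair at `v`, which is no edge of `G`, so it receives
      -- the default color.
      change (if _ then _ else c₀) = c₀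
      exact if_neg fun h' => G.graph.loopless.irrefl v h'
  · rintro ⟨v, i⟩ hi
    refine (Set.ncard_le_ncard (t := (fun k : ℕ => (⟨v, Fin.ofNat _ k⟩ :
      Σ v : V, Fin (n (G.vcolor v) + 1))) '' {(i : ℕ) - 1, (i : ℕ) + 1}) ?_
      (Set.toFinite _)).trans ((Set.ncard_image_le (Set.toFinite _)).trans
        ((Set.ncard_insert_le _ _).trans_eq (by rw [Set.ncard_singleton])))
    rintro ⟨w, j⟩ h
    rcases h with h | ⟨h, h2⟩
    · exact absurd h.2.1 hi
    · simp only at h h2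
      subst h
      refine ⟨j, by simp; omega, ?_⟩
      beta_reduce
      congr 1
      ext
      simp
  · rintro ⟨v, i⟩ hi
    by_cases hl : (i : ℕ) = n (G.vcolor v)
    · left
      rw [Set.ncard_eq_one]
      refine ⟨⟨v, ⟨i - 1, by omega⟩⟩, ?_⟩
      ext ⟨w, j⟩
      simp only [Set.mem_ofPred_eq, Set.mem_singleton_iff]
      constructor
      · rintro (h | ⟨h, h2⟩)
        · exact absurd h.2.1 hi
        · simp only at h h2
          subst h
          have := j.2
          congr 1
          ext
          simp only
          omega
      · intro h
        rw [h]
        refine Or.inr ⟨rfl, Or.inr ?_⟩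
        simp only at hi ⊢
        omega
    · right
      have := i.2
      exact ⟨⟨v, ⟨i + 1, by omega⟩⟩, Or.inr ⟨rfl, Or.inl rfl⟩, Nat.succ_ne_zero _⟩

/-- The new edges all have color `c₀`, so injectivity of `m` on the other colors occurring in `G` is
enough for the enlarged graph. -/
theorem ColoredGraph.exists_ecolor_of_attachPaths (G : ColoredGraph V CV CE) (c₀ : CE)
    (n : CV → ℕ) : {c | c ≠ c₀ ∧ ∃ e ∈ (G.attachPaths n c₀).graph.edgeSet,
      (G.attachPaths n c₀).ecolor e = c} ⊆
    {c | c ≠ c₀ ∧ ∃ e ∈ G.graph.edgeSet, G.ecolor e = c} := by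
  classical
  rintro c ⟨hc, e, -, he⟩
  refine ⟨hc, e.map Sigma.fst, ?_⟩
  simp only [attachPaths] at he
  split_ifs at he with h
  · exact ⟨h, he⟩
  · exact absurd he.symm hc

end AttachPaths

end

theorem theorem4p9 {V : Type*} [Fintype V] [DecidableEq V] {CV CE : Type*}
    (G : ColoredGraph V CV CE) [G.graph.LocallyFinite] (hdeg : ∀ v, 3 ≤ G.graph.degree v)
    (c₀ : CE)
    (n : CV → ℕ) (hn : Set.InjOn n (Set.range G.vcolor))
    (m : CE → ℕ) (hm : Set.InjOn m {c | c ≠ c₀ ∧ ∃ e ∈ G.graph.edgeSet, G.ecolor e = c}) :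
    (qutStar (G.attachPaths n c₀) c₀).IsIsomorphic
      (qut (ColoredGraph.ofGraph ((G.attachPaths n c₀).subdivide c₀ m))) :=
  isIsomorphic_qut_subdivide _ c₀ m (G.hasTails_attachPaths hdeg c₀ n) (fun _ _ => rfl)
    (hm.mono (G.exists_ecolor_of_attachPaths c₀ n))
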